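/- Let $\tau_k=-\tfrac{i}{2}\sigma_k$ ($k=1,2,3$, $\sigma_k$ the Pauli matrices) be the basis of $su(2)$ with $[\tau_i,\tau_j]=\epsilon_{ijk}\tau_k$, and consider $L^2(SU(2))$ with respect to the normalized Haar measure, whose elements are viewed as functions $\psi(h)$ of the holonomy $h$ along a single loop based at one vertex. For $j\in\{0,\tfrac12,1,\tfrac32,\dots\}$ let $|j\rangle$ be the function $h\mapsto \mathrm{Tr}\,D^j(h)$, where $D^j$ is the irreducible representation of $SU(2)$ of spin $j$. Let $\mathcal H_\gamma\subset L^2(SU(2))$ be the closed linear span of the vectors $|j\rangle$, and let $\mathcal F\subset\mathcal H_\gamma$ be the set of their finite linear combinations. For smooth $\psi$ put $$(J^i_{b}\psi)(h)=i\tfrac{d}{dt}\Big|_{t=0}\psi(he^{t\tau_i}),\qquad (J^i_{e}\psi)(h)=i\tfrac{d}{dt}\Big|_{t=0}\psi(e^{-t\tau_i}h),\qquad h^i=-\frac{3}{l(l+1)(2l+1)}\mathrm{Tr}(h\tau_i)\Big|_{l=1/2}=-2\,\mathrm{Tr}(h\tau_i).$$ Let $K$ (the Euclidean part of the Hamiltonian)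 be the linear operator in $\mathcal H_\gamma$ with domain $\mathcal F$ such that $$K|j\rangle=\sum_{i,j',k}\epsilon_{ij'k}\,J^{j'}_{e}J^{k}_{b}\,h^i\,|j\rangle\quad(j\neq 0),\qquad K|0\rangle=0 ,$$ let $K^\dagger$ be its Hilbert space adjoint in $\mathcal H_\gamma$, and let $\hat H_I=\frac{-i}{2}(K-K^\dagger)$. **Theorem.** The operator $\hat H_I$ has domain $\mathcal F$, which is dense in $\mathcal H_\gamma$, and it is symmetric, hence closable. The spectrum of its closure (again denoted by $\hat H_I$) is the whole real line, $\sigma(\hat H_I)=\mathbb R$. The vector $|j=0\rangle$ is an eigenvector with eigenvalue $0$, and $0$ is the only eigenvalue: the point spectrum of $\hat H_I$ is $\{0\}$. -/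

import Mathlib

open MeasureTheory

namespace OneLoop

noncomputable section

/-! ### The gauge group `SU(2)`, the generators `τ_i` and the Haar measure -/

/-- The group `SU(2)`: the holonomy `h_α(A)` of a connection along the loop `α` lies here. -/
abbrev SU2 : Type := Matrix.specialUnitaryGroup (Fin 2) ℂ

/-- The basis `τ_k = -(i/2) σ_k` of `su(2)` (`σ_k` the Pauli matrices). -/
def tau : Fin 3 → Matrix (Fin 2) (Fin 2) ℂ :=
  ![(-(Complex.I / 2)) • !![0, 1; 1, 0],
    (-(Complex.I / 2)) • !![0, -Complex.I; Complex.I, 0],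
    (-(Complex.I / 2)) • !![1, 0; 0, -1]]

/-- The Levi-Civita symbol. -/
def eps (i j k : Fin 3) : ℂ :=
  ((((i : ℕ) : ℤ) - ((j : ℕ) : ℤ)) * (((j : ℕ) : ℤ) - ((k : ℕ) : ℤ)) *
    (((k : ℕ) : ℤ) - ((i : ℕ) : ℤ)) / 2 : ℤ)

/-- The commutation relations `[τ_i, τ_j] = ∑_k ε_{ijk} τ_k`. -/
theorem tau_comm (i j : Fin 3) :
    tau i * tau j - tau j * tau i = ∑ k, eps i j k • tau k := by
  fin_cases i <;> fin_cases j <;> ext a b <;> fin_cases a <;> fin_cases b <;>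
    simp [tau, eps, Fin.sum_univ_three] <;> ring_nf <;> simp <;> ring_nf

theorem tau_sq (i : Fin 3) : (2 • tau i) * (2 • tau i) = -1 := by
  fin_cases i <;> ext a b <;> fin_cases a <;> fin_cases b <;>
    simp [tau, Matrix.mul_apply] <;>
    (try ring_nf) <;> (try simp [Complex.I_sq])

/-- The closed form of the exponential of a generator. -/
theorem exp_tau (i : Fin 3) (t : ℝ) :
    NormedSpace.exp (t • tau i) =
      Real.cos (t / 2) • (1 : Matrix (Fin 2) (Fin 2) ℂ) + Real.sin (t / 2) • (2 • tau i) := by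
  have hf : Continuous (Complex.liftAux (2 • tau i) (tau_sq i)) := by
    have : ⇑(Complex.liftAux (2 • tau i) (tau_sq i)) = fun z : ℂ =>
        algebraMap ℝ (Matrix (Fin 2) (Fin 2) ℂ) z.re + z.im • (2 • tau i) := by
      ext1 z; exact Complex.liftAux_apply _ _ z
    rw [this]
    simp only [Algebra.algebraMap_eq_smul_one]
    fun_prop
  let _ : NormedRing (Matrix (Fin 2) (Fin 2) ℂ) := Matrix.linftyOpNormedRing
  let _ : NormedAlgebra ℝ (Matrix (Fin 2) (Fin 2) ℂ) := Matrix.linftyOpNormedAlgebra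
  have h := NormedSpace.map_exp (Complex.liftAux (2 • tau i) (tau_sq i)) hf
    ((t / 2 : ℝ) * Complex.I)
  have h1 : Complex.liftAux (2 • tau i) (tau_sq i) ((t / 2 : ℝ) * Complex.I) = t • tau i := by
    rw [Complex.liftAux_apply]
    rw [two_nsmul]
    simp
    module
  rw [h1, ← Complex.exp_eq_exp_ℂ, Complex.liftAux_apply, Complex.exp_ofReal_mul_I_re,
    Complex.exp_ofReal_mul_I_im, Algebra.algebraMap_eq_smul_one] at h
  exact h.symm

theorem exp_tau_mem (i : Fin 3) (t : ℝ) :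
    NormedSpace.exp (t • tau i) ∈ Matrix.specialUnitaryGroup (Fin 2) ℂ := by
  rw [exp_tau, Matrix.mem_specialUnitaryGroup_iff, Matrix.mem_unitaryGroup_iff]
  have hc : ((Real.cos (t / 2) : ℝ) : ℂ) ^ 2 + ((Real.sin (t / 2) : ℝ) : ℂ) ^ 2 = 1 := by
    exact_mod_cast Real.cos_sq_add_sin_sq (t / 2)
  generalize Real.cos (t / 2) = c at *
  generalize Real.sin (t / 2) = s at *
  have h2 : (starRingEnd ℂ) 2 = 2 := Complex.conj_ofNat 2
  constructor
  · fin_cases i <;> ext a b <;> fin_cases a <;> fin_cases b <;>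
      simp [tau, Matrix.mul_apply, Fin.sum_univ_two, Matrix.star_apply, h2] <;>
      ring_nf <;> simp <;> linear_combination hc
  · fin_cases i <;>
      simp [tau, Matrix.det_fin_two] <;>
      ring_nf <;> simp <;> linear_combination hc

/-- The one-parameter subgroup `t ↦ e^{t τ_i}` of `SU(2)`. -/
def expTau (i : Fin 3) (t : ℝ) : SU2 := ⟨NormedSpace.exp (t • tau i), exp_tau_mem i t⟩

instance : IsTopologicalGroup SU2 where
  continuous_mul := continuous_mul
  continuous_inv := by
    refine Continuous.subtype_mk (f := fun g : SU2 => star g.1) ?_ _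
    exact continuous_star.comp continuous_subtype_val

instance : CompactSpace SU2 := by
  refine (isCompact_iff_compactSpace (s := (Matrix.specialUnitaryGroup (Fin 2) ℂ :
    Set (Matrix (Fin 2) (Fin 2) ℂ)))).mp ?_
  have hcl : IsClosed (Matrix.specialUnitaryGroup (Fin 2) ℂ : Set (Matrix (Fin 2) (Fin 2) ℂ)) := by
    have : (Matrix.specialUnitaryGroup (Fin 2) ℂ : Set (Matrix (Fin 2) (Fin 2) ℂ)) =
        {A | A * star A = 1} ∩ {A | A.det = 1} := by
      ext A
      simp [Matrix.mem_specialUnitaryGroup_iff, Matrix.mem_unitaryGroup_iff]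
    rw [this]
    exact (isClosed_eq (by fun_prop) continuous_const).inter
      (isClosed_eq (by fun_prop) continuous_const)
  have hK : IsCompact (Set.univ.pi fun _ : Fin 2 => Set.univ.pi fun _ : Fin 2 =>
      Metric.closedBall (0 : ℂ) 1) :=
    isCompact_univ_pi fun _ => isCompact_univ_pi fun _ => isCompact_closedBall 0 1
  refine IsCompact.of_isClosed_subset (X := Matrix (Fin 2) (Fin 2) ℂ) hK hcl ?_
  intro A hA i _ j _
  have := entry_norm_bound_of_unitary (Matrix.specialUnitaryGroup_le_unitaryGroup hA) i j
  simpa using this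

instance : MeasurableSpace SU2 := borel SU2

instance : BorelSpace SU2 := ⟨rfl⟩

/-- The normalized Haar measure of `SU(2)`. -/
def haarSU2 : Measure SU2 := Measure.haarMeasure ⊤

instance : IsProbabilityMeasure haarSU2 := ⟨Measure.haarMeasure_self⟩

/-! ### Spin-network states of the graph consisting of one loop `α` -/

/-- The matrix `D^j(h)` of the irreducible representation of spin `j = n / 2`, realized on the
homogeneous polynomials of degree `n` in `x, y` with basis `x^k y^(n-k)`: the element `h` sends
`x` to `h₀₀ x + h₁₀ y` and `y` to `h₀₁ x + h₁₁ y` (below `y` is dehomogenized to `1`). -/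
def wignerD (n : ℕ) (h : SU2) : Matrix (Fin (n + 1)) (Fin (n + 1)) ℂ :=
  Matrix.of fun m k =>
    ((Polynomial.C (h.1 0 0) * Polynomial.X + Polynomial.C (h.1 1 0)) ^ (k : ℕ) *
      (Polynomial.C (h.1 0 1) * Polynomial.X + Polynomial.C (h.1 1 1)) ^ (n - (k : ℕ))).coeff m

/-- The spin network function `⟨A | j⟩ = Tr D^j(h_α(A))`, `j = n / 2`, as a function of the
holonomy `h_α(A) ∈ SU(2)`. -/
def spinNet (n : ℕ) (h : SU2) : ℂ := (wignerD n h).trace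

theorem continuous_spinNet (n : ℕ) : Continuous (spinNet n) := by
  have key : ∀ (a b : SU2 → ℂ), Continuous a → Continuous b → ∀ r m : ℕ, Continuous fun h =>
      ((Polynomial.C (a h) * Polynomial.X + Polynomial.C (b h)) ^ r).coeff m := by
    intro a b ha hb r
    induction r with
    | zero => intro m; simpa using continuous_const
    | succ r ih =>
      intro m
      simp only [pow_succ, Polynomial.coeff_mul]
      refine continuous_finsetSum _ fun p _ => (ih p.1).mul ?_
      simp only [Polynomial.coeff_add, Polynomial.coeff_C_mul, Polynomial.coeff_C]
      refine (ha.mul continuous_const).add ?_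
      split_ifs
      · exact hb
      · exact continuous_const
  have entry : ∀ i j : Fin 2, Continuous fun h : SU2 => h.1 i j := fun i j =>
    continuous_subtype_val.matrix_elem i j
  unfold spinNet Matrix.trace
  refine continuous_finsetSum _ fun k _ => ?_
  simp only [Matrix.diag_apply, wignerD, Matrix.of_apply, Polynomial.coeff_mul]
  exact continuous_finsetSum _ fun p _ =>
    (key _ _ (entry 0 0) (entry 1 0) _ _).mul (key _ _ (entry 0 1) (entry 1 1) _ _)

/-- The kinematical Hilbert space of the loop: the cylindrical functions `ψ(h_α(A))`, square
integrable with respect to the Haar measure. -/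
abbrev Kin : Type := Lp ℂ 2 haarSU2

/-- `Tr D^j`, `j = n / 2`, as a vector of the kinematical Hilbert space. -/
def spinVec (n : ℕ) : Kin :=
  ContinuousMap.toLp (E := ℂ) 2 haarSU2 ℂ ⟨spinNet n, continuous_spinNet n⟩

/-- The one-loop spin-network Hilbert space: the closed subspace of the kinematical space that
is spanned by the gauge-invariant spin-network states `|j⟩`, `j = 0, 1/2, 1, …`. -/
abbrev Hloop : Type := (Submodule.span ℂ (Set.range spinVec)).topologicalClosure

/-- The basis vector `|j⟩`, `j = n / 2`. -/
def ket (n : ℕ) : Hloop :=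
  ⟨spinVec n, Submodule.le_topologicalClosure _ (Submodule.subset_span ⟨n, rfl⟩)⟩

/-- The space `𝓕` of finite linear combinations of the `|j⟩`. -/
def finiteStates : Submodule ℂ Hloop := Submodule.span ℂ (Set.range ket)

/-! ### The Euclidean part of the Hamiltonian -/

/-- The operator `J^i` at the vertex for the beginning segment of the loop:
`i d/dt ψ(h e^{t τ_i})` at `t = 0`. -/
def Jbegin (i : Fin 3) (ψ : SU2 → ℂ) (h : SU2) : ℂ :=
  Complex.I * deriv (fun t : ℝ => ψ (h * expTau i t)) 0

/-- The operator `J^i` at the vertex for the ending segment of the loop: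
`i d/dt ψ(e^{-t τ_i} h)` at `t = 0`. -/
def Jend (i : Fin 3) (ψ : SU2 → ℂ) (h : SU2) : ℂ :=
  Complex.I * deriv (fun t : ℝ => ψ (expTau i (-t) * h)) 0

/-- The multiplication operator `(h^i_α)^{(l)}` for `l = 1/2`, that is
`-(3 / (l (l + 1) (2 l + 1))) Tr(h τ_i)`. -/
def holTau (i : Fin 3) (h : SU2) : ℂ :=
  -(3 / ((1 / 2) * (1 / 2 + 1) * (2 * (1 / 2) + 1))) * (h.1 * tau i).trace

/-- The expression `∑_{ijk} ε_{ijk} J^j_{end} J^k_{begin} h^i` applied to a function on `SU(2)`. -/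
def euclid (ψ : SU2 → ℂ) (h : SU2) : ℂ :=
  ∑ i, ∑ j, ∑ k, eps i j k * Jend j (Jbegin k fun g => holTau i g * ψ g) h

/-- The Euclidean part `K` of the Hamiltonian as an operator in the spin-network space with
domain `𝓕`: the linear operator with `K|0⟩ = 0` and `K|j⟩` given by `euclid` for `j ≠ 0`.
It is written through its graph, which is spanned by the pairs `(|j⟩, K|j⟩)`. -/
def K : Hloop →ₗ.[ℂ] Hloop :=
  (Submodule.span ℂ {p : Hloop × Hloop | p = (ket 0, 0) ∨
    ∃ n : ℕ, n ≠ 0 ∧ p.1 = ket n ∧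
      ((p.2 : Kin) : SU2 → ℂ) =ᵐ[haarSU2] euclid (spinNet n)}).toLinearPMap

/-- The operator `H_I = (-i/2) (K - K†)`, with its natural domain `dom K ∩ dom K†`. -/
def HI : Hloop →ₗ.[ℂ] Hloop := (-Complex.I / 2) • (K - K.adjoint)

/-! ### Spectrum of an unbounded operator -/

/-- `z` is in the resolvent set of `T`: the operator `T - z` maps the domain of `T` bijectively
onto the whole space, with a bounded inverse `R`. -/
def IsRegularValue {E : Type*} [NormedAddCommGroup E] [NormedSpace ℂ E]
    (T : E →ₗ.[ℂ] E) (z : ℂ) : Prop :=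
  ∃ R : E →L[ℂ] E, (∀ x : T.domain, R (T x - z • (x : E)) = x) ∧
    ∀ y : E, ∃ x : T.domain, (x : E) = R y ∧ T x - z • (x : E) = y

/-- The spectrum of an unbounded operator. -/
def unboundedSpectrum {E : Type*} [NormedAddCommGroup E] [NormedSpace ℂ E]
    (T : E →ₗ.[ℂ] E) : Set ℂ :=
  {z | ¬ IsRegularValue T z}

/-- The point spectrum (the set of eigenvalues) of an unbounded operator. -/
def pointSpectrum {E : Type*} [NormedAddCommGroup E] [NormedSpace ℂ E]
    (T : E →ₗ.[ℂ] E) : Set ℂ :=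
  {z | ∃ x : T.domain, (x : E) ≠ 0 ∧ T x = z • (x : E)}

end

end OneLoop

/-!
On functions of the trace `x = Tr h` the Euclidean operator is the first-order operator
`f ↦ (3/2) x f - ((4 - x²)/2) f'` (`euclid_eval_trace`). The character of spin `n / 2` is the
Chebyshev polynomial `S_n(x)` (`spinNet_eq_eval`), so
`K|n⟩ = ((n+3)/2)|n+1⟩ - ((n-1)/2)|n-1⟩` for `n ≥ 1` (`euclid_spinNet`), where `|n⟩` stands for
the character of spin `n / 2`. The characters form an orthonormal basis: by invariance of the Haar measure a function in the image of the Euclidean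
operator integrates to zero, hence so does every `S_n` with `n ≥ 1`, and products of characters
reduce to this case by `x S_n = S_{n+1} + S_{n-1}`. In this basis, after multiplying the
coefficients by powers of `i`, `H_I` is the zero operator on `|0⟩` together with the Jacobi matrix
with zero diagonal and off-diagonal weights `c_n = (2n+3)/4`, `n ≥ 1`, on the other vectors.

All spectral statements come from the recurrence `c_n q_{n+1} + c_{n-1} q_{n-1} = z q_n`, which has
no nonzero square summable solution for `z ≠ 0` (`IsJacobiSolution.eq_zero`):

* For non-real `z` the weighted Wronskian `c_n Im(conj q_n q_{n+1})` is bounded away from zero, while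
  `∑ 1 / c_n` diverges. This makes the deficiency spaces trivial, so that the closure of `H_I` has
  every non-real number as a regular value.
* For real `z ≠ 0` a corrected energy `c_n (q_n² + q_{n+1}²) - z q_n q_{n+1} + q_{n+1}² / 2` stays
  between positive constants (`exists_bounds_of_recurrence`), so that `q_n² + q_{n+1}²` is of exact
  order `1 / c_n`. The lower bound excludes eigenvalues. The upper bound shows that damping `q` by
  the factors `∏ (1 - s / c_k)` gives square summable vectors on which `H_I - z` has size `O(s)`
  (`exists_approximate_solution`), so `z` is not a regular value.

The number `0` belongs to the spectrum because `|0⟩` is an eigenvector.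
-/

namespace OneLoop

open Polynomial

/-! ### Characters of the irreducible representations as Chebyshev polynomials -/

/-- The trace of the substitution `x ↦ a x + b y`, `y ↦ c x + d y` on binary forms of degree `n`
satisfies the three-term recursion with the coefficients of the characteristic polynomial of
`!![a, c; b, d]`. The sums over the first superdiagonal, `V` below, make the recursion
closed. -/
theorem sum_coeff_binary_form_recursion {R : Type*} [CommRing R] (a b c d : R) (n : ℕ) :
    ∑ k ∈ Finset.range (n + 3), ((C a * X + C b) ^ k * (C c * X + C d) ^ (n + 2 - k)).coeff k =
      (a + d) * ∑ k ∈ Finset.range (n + 2),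
        ((C a * X + C b) ^ k * (C c * X + C d) ^ (n + 1 - k)).coeff k -
      (a * d - b * c) * ∑ k ∈ Finset.range (n + 1),
        ((C a * X + C b) ^ k * (C c * X + C d) ^ (n - k)).coeff k := by
  set u : R[X] := C a * X + C b with hu
  set v : R[X] := C c * X + C d with hv
  set U : ℕ → R := fun n => ∑ k ∈ Finset.range (n + 1), (u ^ k * v ^ (n - k)).coeff k with hU
  set V : ℕ → R := fun n => ∑ k ∈ Finset.range (n + 1), (u ^ k * v ^ (n - k)).coeff (k + 1) with hV
  have stepU (q : R[X]) (m : ℕ) : (u * q).coeff (m + 1) = a * q.coeff m + b * q.coeff (m + 1) := by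
    rw [hu, add_mul, mul_assoc, coeff_add, coeff_C_mul, coeff_X_mul, coeff_C_mul]
  have stepV (q : R[X]) (m : ℕ) : (v * q).coeff (m + 1) = c * q.coeff m + d * q.coeff (m + 1) := by
    rw [hv, add_mul, mul_assoc, coeff_add, coeff_C_mul, coeff_X_mul, coeff_C_mul]
  have v0 (n : ℕ) : (v ^ n).coeff 0 = d ^ n := by
    simp [coeff_zero_eq_eval_zero, hv]
  have udeg : u.natDegree ≤ 1 := natDegree_linear_le
  have utop (n : ℕ) : (u ^ n).coeff (n + 1) = 0 := by
    apply coeff_eq_zero_of_natDegree_lt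
    calc (u ^ n).natDegree ≤ n * 1 := natDegree_pow_le_of_le n udeg
      _ < n + 1 := by omega
  have recU (n : ℕ) : U (n + 1) = d ^ (n + 1) + a * U n + b * V n := by
    simp only [hU, hV]
    rw [Finset.sum_range_succ', Finset.mul_sum, Finset.mul_sum, add_assoc,
      ← Finset.sum_add_distrib, add_comm]
    congr 1
    · simpa using v0 (n + 1)
    · refine Finset.sum_congr rfl fun k _ => ?_
      rw [pow_succ', mul_assoc, stepU, Nat.add_sub_add_right]
  have recV (n : ℕ) : V (n + 1) = c * U n + d * V n := by
    simp only [hU, hV]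
    rw [Finset.sum_range_succ, Finset.mul_sum, Finset.mul_sum, ← Finset.sum_add_distrib]
    have : (u ^ (n + 1) * v ^ (n + 1 - (n + 1))).coeff (n + 1 + 1) = 0 := by
      simpa using utop (n + 1)
    rw [this, add_zero]
    refine Finset.sum_congr rfl fun k hk => ?_
    have hk' : k ≤ n := Nat.lt_succ_iff.mp (Finset.mem_range.mp hk)
    rw [Nat.sub_add_comm hk', pow_succ', mul_left_comm, stepV]
  change U (n + 2) = (a + d) * U (n + 1) - (a * d - b * c) * U n
  rw [recU (n + 1), recV n]
  linear_combination (-d) * recU n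

theorem SU2.det_eq (h : SU2) : h.1 0 0 * h.1 1 1 - h.1 0 1 * h.1 1 0 = 1 := by
  have := (Matrix.mem_specialUnitaryGroup_iff.mp h.2).2
  rwa [Matrix.det_fin_two] at this

theorem spinNet_eq_sum (n : ℕ) (h : SU2) :
    spinNet n h = ∑ k ∈ Finset.range (n + 1),
      ((C (h.1 0 0) * X + C (h.1 1 0)) ^ k * (C (h.1 0 1) * X + C (h.1 1 1)) ^ (n - k)).coeff k := by
  rw [Finset.sum_range]
  rfl

theorem spinNet_zero (h : SU2) : spinNet 0 h = 1 := by
  simp [spinNet_eq_sum]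

theorem spinNet_one (h : SU2) : spinNet 1 h = h.1.trace := by
  simp [spinNet_eq_sum, Finset.sum_range_succ, Matrix.trace_fin_two, coeff_X, coeff_C, add_comm]

theorem spinNet_add_two (n : ℕ) (h : SU2) :
    spinNet (n + 2) h = h.1.trace * spinNet (n + 1) h - spinNet n h := by
  simp only [spinNet_eq_sum]
  rw [sum_coeff_binary_form_recursion, Matrix.trace_fin_two]
  linear_combination (-∑ k ∈ Finset.range (n + 1),
      ((C (h.1 0 0) * X + C (h.1 1 0)) ^ k * (C (h.1 0 1) * X + C (h.1 1 1)) ^ (n - k)).coeff k)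
    * SU2.det_eq h

/-- The character of spin `n / 2` is the rescaled Chebyshev polynomial of the second kind in the
trace. -/
theorem spinNet_eq_eval (n : ℕ) (h : SU2) :
    spinNet n h = (Chebyshev.S ℂ n).eval h.1.trace := by
  induction n using Nat.twoStepInduction with
  | zero => simp [spinNet_zero]
  | one => simp [spinNet_one]
  | more n ih ih' =>
    rw [spinNet_add_two, ih, ih']
    push_cast
    rw [Chebyshev.S_add_two]
    simp

/-- The derivative of the rescaled Chebyshev polynomials in terms of their neighbours. -/
theorem derivative_S (n : ℕ) : (4 - X ^ 2) * derivative (Chebyshev.S ℂ n) =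
    -(n : ℂ[X]) * Chebyshev.S ℂ (n + 1) + (n + 2 : ℂ[X]) * Chebyshev.S ℂ (n - 1) := by
  induction n using Nat.twoStepInduction with
  | zero => simp
  | one => simp [Chebyshev.S_two]; ring
  | more n ih ih' =>
    have e1 : ((n + 1 : ℕ) : ℤ) + 1 = n + 2 := by push_cast; ring
    have e2 : ((n + 1 : ℕ) : ℤ) - 1 = n := by push_cast; ring
    have e3 : ((n + 2 : ℕ) : ℤ) + 1 = n + 1 + 2 := by push_cast; ring
    have e4 : ((n + 2 : ℕ) : ℤ) - 1 = n + 1 := by push_cast; ring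
    rw [e1, e2] at ih'
    rw [e3, e4]
    push_cast at ih' ⊢
    have h3 : Chebyshev.S ℂ ((n : ℤ) + 1 + 2) =
        X * Chebyshev.S ℂ ((n : ℤ) + 2) - Chebyshev.S ℂ ((n : ℤ) + 1) := by
      rw [Chebyshev.S_add_two]; congr 3
    rw [h3, Chebyshev.S_sub_one] at *
    simp only [Chebyshev.S_add_two, derivative_sub, derivative_mul, derivative_X] at ih' ⊢
    linear_combination X * ih' - ih

end OneLoop

namespace OneLoop

open Polynomial

/-! ### The Euclidean operator on the characters -/

theorem expTau_zero (i : Fin 3) : expTau i 0 = 1 := by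
  apply Subtype.ext
  simp [expTau]

theorem expTau_add (i : Fin 3) (s t : ℝ) : expTau i (s + t) = expTau i s * expTau i t := by
  apply Subtype.ext
  change NormedSpace.exp ((s + t) • tau i) =
    NormedSpace.exp (s • tau i) * NormedSpace.exp (t • tau i)
  rw [add_smul]
  exact Matrix.exp_add_of_commute _ _ (((Commute.refl (tau i)).smul_left s).smul_right t)

theorem hasDerivAt_trace_expTau_mul (i : Fin 3) (A : Matrix (Fin 2) (Fin 2) ℂ) :
    HasDerivAt (fun t : ℝ => ((expTau i t).1 * A).trace) (tau i * A).trace 0 := by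
  have hc : HasDerivAt (fun t : ℝ => ((Real.cos (t / 2) : ℝ) : ℂ)) 0 0 := by
    have := ((Real.hasDerivAt_cos (0 / 2)).comp 0 ((hasDerivAt_id (0 : ℝ)).div_const 2)).ofReal_comp
    simpa [Function.comp_def] using this
  have hs : HasDerivAt (fun t : ℝ => ((Real.sin (t / 2) : ℝ) : ℂ)) (1 / 2) 0 := by
    have := ((Real.hasDerivAt_sin (0 / 2)).comp 0 ((hasDerivAt_id (0 : ℝ)).div_const 2)).ofReal_comp
    simpa [Function.comp_def] using this
  convert! (hc.mul_const A.trace).add (hs.mul_const (2 * (tau i * A).trace)) using 1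
  · funext t
    change (NormedSpace.exp (t • tau i) * A).trace = _
    rw [exp_tau, add_mul, Matrix.trace_add, Matrix.smul_mul, Matrix.smul_mul, Matrix.trace_smul,
      Matrix.trace_smul, one_mul, two_nsmul, add_mul, Matrix.trace_add, two_mul]
    simp only [Pi.add_apply, Complex.real_smul]
  · ring

theorem hasDerivAt_trace_mul_expTau (h : SU2) (i : Fin 3) (A : Matrix (Fin 2) (Fin 2) ℂ) :
    HasDerivAt (fun t : ℝ => ((h * expTau i t).1 * A).trace) (h.1 * tau i * A).trace 0 := by
  convert! hasDerivAt_trace_expTau_mul i (A * h.1) using 1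
  · funext t
    change (h.1 * (expTau i t).1 * A).trace = _
    rw [mul_assoc, Matrix.trace_mul_comm, mul_assoc]
  · rw [mul_assoc, Matrix.trace_mul_comm, mul_assoc]

theorem hasDerivAt_trace_expTau_neg_mul (h : SU2) (i : Fin 3) (A : Matrix (Fin 2) (Fin 2) ℂ) :
    HasDerivAt (fun t : ℝ => ((expTau i (-t) * h).1 * A).trace) (-(tau i * h.1 * A).trace) 0 := by
  have h0 : HasDerivAt (fun t : ℝ => ((expTau i t).1 * (h.1 * A)).trace)
      (tau i * (h.1 * A)).trace (-0) := by
    simpa using hasDerivAt_trace_expTau_mul i (h.1 * A)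
  have := h0.scomp (0 : ℝ) (hasDerivAt_neg (0 : ℝ))
  convert! this using 1
  · funext t
    change ((expTau i (-t)).1 * h.1 * A).trace = _
    rw [mul_assoc]; rfl
  · simp [mul_assoc]

theorem hasDerivAt_eval_comp (P : ℂ[X]) {f : ℝ → ℂ} {f' : ℂ} {t : ℝ} (hf : HasDerivAt f f' t) :
    HasDerivAt (fun s => P.eval (f s)) ((derivative P).eval (f t) * f') t := by
  simpa [mul_comm] using! (P.hasDerivAt (f t)).scomp t hf

theorem hasDerivAt_trace_mul_eval_right (P : ℂ[X]) (h : SU2) (i : Fin 3)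
    (A : Matrix (Fin 2) (Fin 2) ℂ) :
    HasDerivAt (fun t : ℝ => ((h * expTau i t).1 * A).trace * P.eval (h * expTau i t).1.trace)
      ((h.1 * tau i * A).trace * P.eval h.1.trace +
        (h.1 * A).trace * ((derivative P).eval h.1.trace * (h.1 * tau i).trace)) 0 := by
  have h1 := hasDerivAt_trace_mul_expTau h i 1
  simp only [mul_one] at h1
  have := (hasDerivAt_trace_mul_expTau h i A).mul (hasDerivAt_eval_comp P h1)
  simpa [expTau_zero] using! this

theorem hasDerivAt_trace_mul_eval_left (P : ℂ[X]) (h : SU2) (i : Fin 3)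
    (A : Matrix (Fin 2) (Fin 2) ℂ) :
    HasDerivAt (fun t : ℝ => ((expTau i (-t) * h).1 * A).trace *
        P.eval (expTau i (-t) * h).1.trace)
      (-(tau i * h.1 * A).trace * P.eval h.1.trace -
        (h.1 * A).trace * ((derivative P).eval h.1.trace * (tau i * h.1).trace)) 0 := by
  have h1 := hasDerivAt_trace_expTau_neg_mul h i 1
  simp only [mul_one] at h1
  have := (hasDerivAt_trace_expTau_neg_mul h i A).mul (hasDerivAt_eval_comp P h1)
  simpa [expTau_zero, sub_eq_add_neg] using! this

theorem holTau_eq (i : Fin 3) (h : SU2) : holTau i h = -2 * (h.1 * tau i).trace := by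
  unfold holTau
  norm_num

theorem Jbegin_holTau_mul_eval (P : ℂ[X]) (i k : Fin 3) (h : SU2) :
    Jbegin k (fun g => holTau i g * P.eval g.1.trace) h =
      (-2 * Complex.I) * ((h.1 * (tau k * tau i)).trace * P.eval h.1.trace +
        (h.1 * tau i).trace * (h.1 * tau k).trace * (derivative P).eval h.1.trace) := by
  have := (hasDerivAt_trace_mul_eval_right P h k (tau i)).const_mul (-2 : ℂ)
  unfold Jbegin
  simp only [holTau_eq, mul_assoc] at this ⊢
  rw [this.deriv]
  ring

theorem Jend_Jbegin_holTau_mul_eval (P : ℂ[X]) (i j k : Fin 3) (h : SU2) :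
    Jend j (Jbegin k fun g => holTau i g * P.eval g.1.trace) h =
      (-2 : ℂ) * ((tau j * h.1 * (tau k * tau i)).trace * P.eval h.1.trace +
        (h.1 * (tau k * tau i)).trace * ((derivative P).eval h.1.trace * (tau j * h.1).trace) +
        (tau j * h.1 * tau i).trace * ((h.1 * tau k).trace * (derivative P).eval h.1.trace) +
        (h.1 * tau i).trace * ((tau j * h.1 * tau k).trace * (derivative P).eval h.1.trace +
          (h.1 * tau k).trace *
            ((derivative (derivative P)).eval h.1.trace * (tau j * h.1).trace))) := by
  have h1 := hasDerivAt_trace_mul_eval_left P h j (tau k * tau i)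
  have h2 := (hasDerivAt_trace_expTau_neg_mul h j (tau i)).mul
    (hasDerivAt_trace_mul_eval_left (derivative P) h j (tau k))
  have h3 := (h1.add h2).const_mul (-2 * Complex.I)
  unfold Jend
  rw [show (Jbegin k fun g => holTau i g * P.eval g.1.trace) = _ from
    funext (Jbegin_holTau_mul_eval P i k)]
  have h4 := h3.deriv
  simp only [Pi.add_apply, Pi.mul_apply] at h4
  simp only [mul_assoc] at h4 ⊢
  erw [h4]
  simp only [neg_zero, expTau_zero, one_mul]
  linear_combination ((-2 : ℂ) * ((tau j * (h.1 * (tau k * tau i))).trace * P.eval h.1.trace +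
        (h.1 * (tau k * tau i)).trace * ((derivative P).eval h.1.trace * (tau j * h.1).trace) +
        (tau j * (h.1 * tau i)).trace * ((h.1 * tau k).trace * (derivative P).eval h.1.trace) +
        (h.1 * tau i).trace * ((tau j * (h.1 * tau k)).trace * (derivative P).eval h.1.trace +
          (h.1 * tau k).trace *
            ((derivative (derivative P)).eval h.1.trace * (tau j * h.1).trace)))) * (-Complex.I_sq)

theorem tau_zero : tau 0 = !![0, -(Complex.I / 2); -(Complex.I / 2), 0] := by
  simp [tau]

theorem tau_one : tau 1 = !![0, -(1 / 2); 1 / 2, 0] := by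
  ext a b
  fin_cases a <;> fin_cases b <;> simp [tau] <;> ring_nf <;> simp <;> norm_num

theorem tau_two : tau 2 = !![-(Complex.I / 2), 0; 0, Complex.I / 2] := by
  simp [tau]

theorem sum_trace_mul_tau_sq (h : SU2) :
    ∑ j, (h.1 * tau j).trace * (tau j * h.1).trace = 1 - h.1.trace ^ 2 / 4 := by
  have hdet := SU2.det_eq h
  generalize h.1 = M at *
  rw [Matrix.eta_fin_two M] at *
  simp [Fin.sum_univ_three, tau_zero, tau_one, tau_two, Matrix.trace_fin_two] at hdet ⊢
  ring_nf
  simp only [Complex.I_sq]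
  linear_combination hdet

theorem sum_trace_tau_mul_mul_tau (h : SU2) :
    ∑ j, (tau j * h.1 * tau j).trace = -(3 / 4) * h.1.trace := by
  generalize h.1 = M
  rw [Matrix.eta_fin_two M]
  simp [Fin.sum_univ_three, tau_zero, tau_one, tau_two, Matrix.trace_fin_two]
  ring_nf
  simp only [Complex.I_sq]
  ring

/-- The Euclidean operator acts on class functions as a first-order differential operator in the
trace. The terms with second derivatives are symmetric in two indices of the Levi-Civita symbol
and cancel. -/
theorem euclid_eval_trace (P : ℂ[X]) (h : SU2) :
    euclid (fun g => P.eval g.1.trace) h =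
      3 / 2 * h.1.trace * P.eval h.1.trace -
        (4 - h.1.trace ^ 2) / 2 * (derivative P).eval h.1.trace := by
  have key : euclid (fun g => P.eval g.1.trace) h =
      -2 * ((∑ j, (tau j * h.1 * tau j).trace) * P.eval h.1.trace +
        (∑ j, (h.1 * tau j).trace * (tau j * h.1).trace) * (derivative P).eval h.1.trace) := by
    unfold euclid
    simp only [Jend_Jbegin_holTau_mul_eval]
    generalize P.eval h.1.trace = p
    generalize (derivative P).eval h.1.trace = p'
    generalize (derivative (derivative P)).eval h.1.trace = p''
    generalize h.1 = M
    rw [Matrix.eta_fin_two M]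
    simp [Fin.sum_univ_three, eps, tau_zero, tau_one, tau_two, Matrix.trace_fin_two]
    ring_nf
    simp only [Complex.I_sq]
    ring
  rw [key, sum_trace_mul_tau_sq, sum_trace_tau_mul_mul_tau]
  ring

theorem euclid_spinNet (n : ℕ) (h : SU2) :
    euclid (spinNet n) h =
      (n + 3) / 2 * spinNet (n + 1) h - (n - 1) / 2 * (Chebyshev.S ℂ (n - 1)).eval h.1.trace := by
  have hd := congrArg (Polynomial.eval h.1.trace) (derivative_S n)
  have hr := congrArg (Polynomial.eval h.1.trace) (Chebyshev.S_add_one ℂ n)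
  rw [show spinNet n = fun g => (Chebyshev.S ℂ n).eval g.1.trace from
    funext (spinNet_eq_eval n), euclid_eval_trace, spinNet_eq_eval]
  simp at hd hr
  push_cast
  linear_combination (-1 / 2) * hd - 3 / 2 * hr

end OneLoop

namespace OneLoop

open Polynomial

/-! ### Orthonormality of the characters -/

instance : haarSU2.IsMulLeftInvariant :=
  inferInstanceAs (Measure.haarMeasure ⊤).IsMulLeftInvariant

theorem integrable_haarSU2 {f : SU2 → ℂ} (hf : Continuous f) : Integrable f haarSU2 :=
  hf.integrable_of_hasCompactSupport (HasCompactSupport.of_compactSpace f)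

/-- The integral of a right-invariant vector field applied to a function vanishes, because the
Haar measure is left-invariant. -/
theorem integral_deriv_expTau_mul_eq_zero (i : Fin 3) {f f' : SU2 → ℂ} (hf : Continuous f)
    (hf' : Continuous f')
    (hd : ∀ h, HasDerivAt (fun t : ℝ => f (expTau i (-t) * h)) (f' h) 0) :
    ∫ h, f' h ∂haarSU2 = 0 := by
  obtain ⟨B, hB⟩ := (isCompact_range hf').isBounded.exists_norm_le
  have hd' (h : SU2) (t : ℝ) :
      HasDerivAt (fun t : ℝ => f (expTau i (-t) * h)) (f' (expTau i (-t) * h)) t := by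
    have h1 : HasDerivAt (fun s : ℝ => f (expTau i (-s) * (expTau i (-t) * h)))
        (f' (expTau i (-t) * h)) (t - t) := by simpa using hd (expTau i (-t) * h)
    have h2 := h1.comp_sub_const t t
    convert! h2 using 1
    funext s
    rw [← mul_assoc, ← expTau_add]
    congr 3
    ring
  have hmul (t : ℝ) : Continuous fun h : SU2 => expTau i (-t) * h := continuous_const.mul continuous_id
  have key := (hasDerivAt_integral_of_dominated_loc_of_deriv_le (μ := haarSU2)
    (F := fun (t : ℝ) h => f (expTau i (-t) * h)) (F' := fun (t : ℝ) h => f' (expTau i (-t) * h))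
    (x₀ := 0) (s := Set.univ) (bound := fun _ => B) Filter.univ_mem
    (Filter.Eventually.of_forall fun t => (hf.comp (hmul t)).aestronglyMeasurable)
    (integrable_haarSU2 (hf.comp (hmul 0)))
    (hf'.comp (hmul 0)).aestronglyMeasurable
    (Filter.Eventually.of_forall fun h t _ => hB _ ⟨_, rfl⟩)
    (integrable_const _)
    (Filter.Eventually.of_forall fun h t _ => hd' h t)).2
  have hconst : (fun t : ℝ => ∫ h, f (expTau i (-t) * h) ∂haarSU2) = fun _ => ∫ h, f h ∂haarSU2 := by
    funext t
    exact integral_mul_left_eq_self f (expTau i (-t))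
  rw [hconst] at key
  have := key.unique (hasDerivAt_const _ _)
  simpa [expTau_zero] using this

theorem continuous_trace_mul (A B : Matrix (Fin 2) (Fin 2) ℂ) :
    Continuous fun h : SU2 => (A * h.1 * B).trace := by
  have : Continuous fun h : SU2 => h.1 := continuous_subtype_val
  fun_prop

theorem continuous_eval_trace (P : ℂ[X]) : Continuous fun h : SU2 => P.eval h.1.trace := by
  have : Continuous fun h : SU2 => h.1 := continuous_subtype_val
  fun_prop

theorem integral_euclid_eval_trace (P : ℂ[X]) :
    ∫ h : SU2, (3 / 2 * h.1.trace * P.eval h.1.trace -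
        (4 - h.1.trace ^ 2) / 2 * (derivative P).eval h.1.trace) ∂haarSU2 = 0 := by
  have c1 (A) : Continuous fun h : SU2 => (h.1 * A).trace := by
    simpa using continuous_trace_mul 1 A
  have c2 (A) : Continuous fun h : SU2 => (A * h.1).trace := by
    simpa using continuous_trace_mul A 1
  have hcont (j : Fin 3) : Continuous fun h : SU2 => -(tau j * h.1 * tau j).trace * P.eval h.1.trace -
        (h.1 * tau j).trace * ((derivative P).eval h.1.trace * (tau j * h.1).trace) :=
    ((continuous_trace_mul _ _).neg.mul (continuous_eval_trace P)).sub
      ((c1 _).mul ((continuous_eval_trace _).mul (c2 _)))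
  have h0 (j : Fin 3) := integral_deriv_expTau_mul_eq_zero j
    ((c1 (tau j)).mul (continuous_eval_trace P)) (hcont j)
    (fun h => hasDerivAt_trace_mul_eval_left P h j (tau j))
  have hsum (h : SU2) : 3 / 2 * h.1.trace * P.eval h.1.trace -
        (4 - h.1.trace ^ 2) / 2 * (derivative P).eval h.1.trace =
      2 * ∑ j, (-(tau j * h.1 * tau j).trace * P.eval h.1.trace -
        (h.1 * tau j).trace * ((derivative P).eval h.1.trace * (tau j * h.1).trace)) := by
    have e : ∑ j, (-(tau j * h.1 * tau j).trace * P.eval h.1.trace -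
        (h.1 * tau j).trace * ((derivative P).eval h.1.trace * (tau j * h.1).trace)) =
        -((∑ j, (tau j * h.1 * tau j).trace) * P.eval h.1.trace) -
        (∑ j, (h.1 * tau j).trace * (tau j * h.1).trace) * (derivative P).eval h.1.trace := by
      simp only [Fin.sum_univ_three]
      ring
    rw [e, sum_trace_mul_tau_sq, sum_trace_tau_mul_mul_tau]
    ring
  simp only [hsum]
  rw [integral_const_mul, integral_finsetSum _ fun j _ => integrable_haarSU2 (hcont j)]
  rw [Finset.sum_eq_zero fun j _ => h0 j, mul_zero]

theorem integral_spinNet (n : ℕ) : ∫ h, spinNet n h ∂haarSU2 = if n = 0 then 1 else 0 := by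
  have step (n : ℕ) : ∫ h : SU2, ((n + 3) / 2 * spinNet (n + 1) h -
      (n - 1) / 2 * (Chebyshev.S ℂ (n - 1)).eval h.1.trace) ∂haarSU2 = 0 := by
    have h1 := integral_euclid_eval_trace (Chebyshev.S ℂ n)
    simp only [← euclid_eval_trace] at h1
    simp only [← euclid_spinNet]
    rw [show spinNet n = fun g => (Chebyshev.S ℂ n).eval g.1.trace from
      funext (spinNet_eq_eval n)]
    exact h1
  induction n using Nat.twoStepInduction with
  | zero => simp [spinNet_zero]
  | one =>
    have := step 0
    simp [integral_const_mul] at this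
    simpa using this
  | more n ih _ =>
    have := step (n + 1)
    have e : (((n + 1 : ℕ) : ℤ) - 1) = (n : ℤ) := by push_cast; ring
    simp only [e, ← spinNet_eq_eval] at this
    rw [integral_sub ((integrable_haarSU2 (continuous_spinNet _)).const_mul _)
      ((integrable_haarSU2 (continuous_spinNet _)).const_mul _), integral_const_mul,
      integral_const_mul, ih] at this
    have h4 : ((n : ℂ) + 4) ≠ 0 := by exact_mod_cast (by omega : n + 4 ≠ 0)
    rw [if_neg (by omega)]
    rcases eq_or_ne n 0 with rfl | hn
    · simpa [show (1 + 3 : ℂ) ≠ 0 by norm_num] using this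
    · rw [if_neg hn, mul_zero, sub_zero] at this
      refine (mul_eq_zero.mp this).resolve_left fun h => h4 ?_
      push_cast at h
      linear_combination 2 * h

theorem integral_spinNet_mul_spinNet (n m : ℕ) :
    ∫ h, spinNet n h * spinNet m h ∂haarSU2 = if n = m then 1 else 0 := by
  have hint (n m : ℕ) : Integrable (fun h => spinNet n h * spinNet m h) haarSU2 :=
    integrable_haarSU2 ((continuous_spinNet n).mul (continuous_spinNet m))
  have tr (n : ℕ) (h : SU2) : h.1.trace * spinNet (n + 1) h = spinNet (n + 2) h + spinNet n h := by
    rw [spinNet_add_two]; ring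
  have tr0 (h : SU2) : h.1.trace = spinNet 1 h := (spinNet_one h).symm
  induction m using Nat.twoStepInduction generalizing n with
  | zero => simpa [spinNet_zero] using integral_spinNet n
  | one =>
    rcases n with _ | n
    · simpa [spinNet_zero] using integral_spinNet 1
    · have (h : SU2) : spinNet (n + 1) h * spinNet 1 h = spinNet (n + 2) h + spinNet n h := by
        rw [← tr0, ← tr, mul_comm]
      simp only [this]
      rw [integral_add (integrable_haarSU2 (continuous_spinNet _))
        (integrable_haarSU2 (continuous_spinNet _)), integral_spinNet, integral_spinNet]
      simp
  | more m ih ih' =>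
    rcases n with _ | n
    · simpa [spinNet_zero] using integral_spinNet (m + 2)
    · have (h : SU2) : spinNet (n + 1) h * spinNet (m + 2) h =
          spinNet (n + 2) h * spinNet (m + 1) h + spinNet n h * spinNet (m + 1) h -
            spinNet (n + 1) h * spinNet m h := by
        linear_combination spinNet (m + 1) h * tr n h - spinNet (n + 1) h * tr m h
      simp only [this]
      rw [integral_sub (by exact (hint _ _).add (hint _ _)) (hint _ _),
        integral_add (hint _ _) (hint _ _), ih', ih', ih]
      simp only [show n + 2 = m + 1 ↔ n + 1 = m by omega,
        show n + 1 = m + 2 ↔ n = m + 1 by omega]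
      ring

theorem conj_trace (h : SU2) : (starRingEnd ℂ) h.1.trace = h.1.trace := by
  have hu := (Matrix.mem_specialUnitaryGroup_iff.mp h.2)
  -- the inverse of a unimodular matrix is its adjugate, which has the same trace
  have h1 : star h.1 = h.1.adjugate := by
    have h2 : h.1 * h.1.adjugate = 1 := by rw [Matrix.mul_adjugate, hu.2, one_smul]
    have h3 := Matrix.mem_unitaryGroup_iff'.mp hu.1
    calc star h.1 = star h.1 * (h.1 * h.1.adjugate) := by rw [h2, mul_one]
      _ = h.1.adjugate := by rw [← mul_assoc, h3, one_mul]
  have h4 := congrArg Matrix.trace h1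
  rw [Matrix.star_eq_conjTranspose, Matrix.trace_conjTranspose, Matrix.adjugate_fin_two] at h4
  rw [starRingEnd_apply, h4]
  simp [Matrix.trace_fin_two, add_comm]

theorem conj_spinNet (n : ℕ) (h : SU2) : (starRingEnd ℂ) (spinNet n h) = spinNet n h := by
  induction n using Nat.twoStepInduction with
  | zero => simp [spinNet_zero]
  | one => rw [spinNet_one, conj_trace]
  | more n ih ih' => rw [spinNet_add_two, map_sub, map_mul, ih, ih', conj_trace]

theorem orthonormal_ket : Orthonormal ℂ ket := by
  rw [orthonormal_iff_ite]
  intro n m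
  change inner ℂ (spinVec n) (spinVec m) = _
  unfold spinVec
  rw [ContinuousMap.inner_toLp, ← integral_spinNet_mul_spinNet n m]
  simp only [ContinuousMap.coe_mk, conj_spinNet, mul_comm]

theorem dense_finiteStates : Dense (finiteStates : Set Hloop) := by
  have himg : (Subtype.val '' (finiteStates : Set Hloop) : Set Kin) =
      Submodule.span ℂ (Set.range spinVec) := by
    have := Submodule.map_span
      (Submodule.span ℂ (Set.range spinVec)).topologicalClosure.subtype (Set.range ket)
    rw [← Set.range_comp] at this
    exact congrArg SetLike.coe this
  rw [Subtype.dense_iff]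
  intro x hx
  exact (congrArg (x ∈ closure ·) himg).mpr hx

/-- The spin-network basis of the one-loop space. -/
noncomputable def ketBasis : HilbertBasis ℕ ℂ Hloop :=
  HilbertBasis.mk orthonormal_ket
    (Submodule.dense_iff_topologicalClosure_eq_top.mp dense_finiteStates).ge

theorem ketBasis_apply (n : ℕ) : ketBasis n = ket n := by
  exact congrFun (HilbertBasis.coe_mk orthonormal_ket _) n

end OneLoop

namespace OneLoop

/-! ### Asymptotics of the three-term recurrence -/

/-- The weight of the link between the levels `n` and `n + 1` in the Jacobi matrix of `H_I`. The
link between the levels `0` and `1` is cut. -/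
noncomputable def hop (n : ℕ) : ℝ := if n = 0 then 0 else (2 * n + 3) / 4

theorem hop_zero : hop 0 = 0 := if_pos rfl

theorem hop_succ (n : ℕ) : hop (n + 1) = (2 * n + 5) / 4 := by
  rw [hop, if_neg n.succ_ne_zero]
  push_cast
  ring

theorem hop_succ_pos (n : ℕ) : 0 < hop (n + 1) := by
  rw [hop_succ]
  positivity

theorem hop_nonneg (n : ℕ) : 0 ≤ hop n := by
  cases n with
  | zero => exact hop_zero.ge
  | succ n => exact (hop_succ_pos n).le

theorem hop_add_two (n : ℕ) : hop (n + 2) = hop (n + 1) + 1 / 2 := by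
  rw [hop_succ, hop_succ]
  push_cast
  ring

theorem hop_monotone : Monotone hop := by
  refine monotone_nat_of_le_succ fun n => ?_
  cases n with
  | zero => rw [hop_zero]; exact hop_nonneg 1
  | succ n => rw [hop_add_two]; linarith

theorem tendsto_hop : Filter.Tendsto hop Filter.atTop Filter.atTop := by
  refine Filter.tendsto_atTop_mono (f := fun n : ℕ => (n : ℝ) / 2 ) (fun n => ?_)
    (tendsto_natCast_atTop_atTop.atTop_div_const two_pos)
  cases n with
  | zero => simp [hop_zero]
  | succ n => rw [hop_succ]; push_cast; linarith

theorem not_summable_inv_hop (N : ℕ) : ¬ Summable fun n => (hop (n + N))⁻¹ := by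
  intro h
  have h1 : Summable fun n => (hop n)⁻¹ := (summable_nat_add_iff N).mp h
  refine Real.not_summable_natCast_inv ?_
  refine Summable.of_nonneg_of_le (fun n => by positivity) (fun n => ?_) (h1.mul_left 2)
  rcases n with _ | n
  · simp [hop_zero]
  · rw [hop_succ, ← div_eq_mul_inv, le_div_iff₀ (by positivity), inv_mul_eq_div,
      div_le_iff₀ (by positivity)]
    push_cast
    linarith

/-- A real solution of `c_{n+1} p_{n+2} + c_n p_n = z p_{n+1}` that is nonzero at level `1` is of
exact order `c_n^{-1/2}`. The quantity `c_n (p_n² + p_{n+1}²) - z p_n p_{n+1} + p_{n+1}² / 2`, here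
`W n`, is positive, comparable to `c_n (p_n² + p_{n+1}²)`, and its relative increments are bounded
by a multiple of `1 / c_n - 1 / c_{n+1}`, which is summable. -/
theorem exists_bounds_of_recurrence {z : ℝ} {p : ℕ → ℝ}
    (hp : ∀ n, hop (n + 1) * p (n + 2) + hop n * p n = z * p (n + 1)) (hp1 : p 1 ≠ 0) :
    ∃ N : ℕ, ∃ δ > 0, ∃ C > 0, ∀ n ≥ N, 0 < hop n ∧ δ ≤ hop n * (p n ^ 2 + p (n + 1) ^ 2) ∧
      hop n * (p n ^ 2 + p (n + 1) ^ 2) ≤ C := by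
  set W : ℕ → ℝ := fun n =>
    hop n * (p n ^ 2 + p (n + 1) ^ 2) - z * p n * p (n + 1) + p (n + 1) ^ 2 / 2 with hW
  -- a quadratic form in two consecutive entries that increases exactly
  have hE (n : ℕ) : hop 1 ^ 2 * p 1 ^ 2 ≤ hop (n + 1) ^ 2 * (p (n + 1) ^ 2 + p (n + 2) ^ 2) -
      z * hop (n + 1) * p (n + 1) * p (n + 2) := by
    induction n with
    | zero =>
      have h0 := hp 0
      rw [hop_zero] at h0
      simp only [zero_add] at h0 ⊢
      refine le_of_eq ?_
      linear_combination (-(hop 1 * p 2)) * h0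
    | succ n ih =>
      have h1 := hp (n + 1)
      have h2 : hop (n + 1) ^ 2 ≤ hop (n + 2) ^ 2 :=
        pow_le_pow_left₀ (hop_nonneg _) (hop_monotone (Nat.le_succ _)) 2
      have h3 : hop (n + 2) ^ 2 * (p (n + 2) ^ 2 + p (n + 3) ^ 2) -
          z * hop (n + 2) * p (n + 2) * p (n + 3) =
          hop (n + 1) ^ 2 * (p (n + 1) ^ 2 + p (n + 2) ^ 2) -
            z * hop (n + 1) * p (n + 1) * p (n + 2) +
            (hop (n + 2) ^ 2 - hop (n + 1) ^ 2) * p (n + 2) ^ 2 := by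
        linear_combination (hop (n + 2) * p (n + 3) - hop (n + 1) * p (n + 1)) * h1
      change _ ≤ hop (n + 2) ^ 2 * (p (n + 2) ^ 2 + p (n + 3) ^ 2) -
          z * hop (n + 2) * p (n + 2) * p (n + 3)
      rw [h3]
      nlinarith [sq_nonneg (p (n + 2))]
  have hWpos (n : ℕ) : 0 < W (n + 1) := by
    have h1 : 0 < hop 1 ^ 2 * p 1 ^ 2 := by
      have := hop_succ_pos 0
      positivity
    refine pos_of_mul_pos_right (a := hop (n + 1)) ?_ (hop_nonneg _)
    have h2 : 0 ≤ hop (n + 1) * (p (n + 2) ^ 2 / 2) :=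
      mul_nonneg (hop_nonneg _) (by positivity)
    have h3 : hop (n + 1) * W (n + 1) = hop (n + 1) ^ 2 * (p (n + 1) ^ 2 + p (n + 2) ^ 2) -
      z * hop (n + 1) * p (n + 1) * p (n + 2) + hop (n + 1) * (p (n + 2) ^ 2 / 2) := by
      simp only [hW]
      ring
    linarith [hE n]
  have hWstep (n : ℕ) : 2 * hop (n + 1) * (W (n + 2) - W (n + 1)) =
      z * p (n + 2) * p (n + 3) - p (n + 3) ^ 2 / 2 := by
    have h1 := hp (n + 1)
    have h2 := hop_add_two n
    simp only [hW]
    change hop (n + 2) * p (n + 3) + hop (n + 1) * p (n + 1) = z * p (n + 2) at h1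
    change 2 * hop (n + 1) * (hop (n + 2) * (p (n + 2) ^ 2 + p (n + 3) ^ 2) -
      z * p (n + 2) * p (n + 3) + p (n + 3) ^ 2 / 2 - (hop (n + 1) * (p (n + 1) ^ 2 +
        p (n + 2) ^ 2) - z * p (n + 1) * p (n + 2) + p (n + 2) ^ 2 / 2)) = _
    rw [h2] at h1 ⊢
    linear_combination 2 * ((hop (n + 1) + 1 / 2) * p (n + 3) - hop (n + 1) * p (n + 1)) * h1
  set B : ℝ := |z| + 1 with hB
  have hB1 : 1 ≤ B := by linarith [abs_nonneg z]
  have hzp (n : ℕ) : |z * p n * p (n + 1)| ≤ |z| / 2 * (p n ^ 2 + p (n + 1) ^ 2) := by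
    rw [mul_assoc, abs_mul, div_mul_eq_mul_div, mul_div_assoc]
    refine mul_le_mul_of_nonneg_left ?_ (abs_nonneg z)
    rw [abs_le]
    constructor <;> nlinarith [sq_nonneg (p n + p (n + 1)), sq_nonneg (p n - p (n + 1))]
  obtain ⟨M, hM⟩ := Filter.eventually_atTop.mp (tendsto_hop.eventually_ge_atTop B)
  have hlow (n : ℕ) (hn : M ≤ n) : hop n * (p n ^ 2 + p (n + 1) ^ 2) ≤ 2 * W n := by
    have h1 := (abs_le.mp (hzp n)).2
    have h2 := mul_le_mul_of_nonneg_right (hM n hn)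
      (add_nonneg (sq_nonneg (p n)) (sq_nonneg (p (n + 1))))
    simp only [hW]
    nlinarith [sq_nonneg (p n), sq_nonneg (p (n + 1))]
  have hupp (n : ℕ) (hn : M ≤ n) : W n ≤ 2 * (hop n * (p n ^ 2 + p (n + 1) ^ 2)) := by
    have h1 := (abs_le.mp (hzp n)).1
    have h2 := mul_le_mul_of_nonneg_right (hM n hn)
      (add_nonneg (sq_nonneg (p n)) (sq_nonneg (p (n + 1))))
    simp only [hW]
    nlinarith [sq_nonneg (p n), sq_nonneg (p (n + 1)),
      mul_nonneg (abs_nonneg z) (add_nonneg (sq_nonneg (p n)) (sq_nonneg (p (n + 1))))]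
  have hrel (n : ℕ) (hn : M ≤ n + 1) : |W (n + 2) - W (n + 1)| ≤
      (B / hop (n + 1) - B / hop (n + 2)) * W (n + 2) := by
    have hc1 := hop_succ_pos n
    have hc2 := hop_succ_pos (n + 1)
    have h1 : B / hop (n + 1) - B / hop (n + 2) = B / (2 * hop (n + 1) * hop (n + 2)) := by
      rw [hop_add_two] at hc2 ⊢
      field_simp
      ring
    have h2 : |2 * hop (n + 1) * (W (n + 2) - W (n + 1))| ≤
        B / 2 * (p (n + 2) ^ 2 + p (n + 3) ^ 2) := by
      rw [hWstep]
      refine (abs_sub _ _).trans ?_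
      rw [abs_of_nonneg (show 0 ≤ p (n + 3) ^ 2 / 2 by positivity)]
      have := hzp (n + 2)
      change |z * p (n + 2) * p (n + 3)| ≤ |z| / 2 * (p (n + 2) ^ 2 + p (n + 3) ^ 2) at this
      nlinarith [sq_nonneg (p (n + 2))]
    rw [abs_mul, abs_of_pos (show 0 < 2 * hop (n + 1) by positivity)] at h2
    have h3 := hlow (n + 2) (by omega)
    change hop (n + 2) * (p (n + 2) ^ 2 + p (n + 3) ^ 2) ≤ 2 * W (n + 2) at h3
    rw [h1, div_mul_eq_mul_div, le_div_iff₀ (by positivity)]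
    calc |W (n + 2) - W (n + 1)| * (2 * hop (n + 1) * hop (n + 2))
        = 2 * hop (n + 1) * |W (n + 2) - W (n + 1)| * hop (n + 2) := by ring
      _ ≤ B / 2 * (p (n + 2) ^ 2 + p (n + 3) ^ 2) * hop (n + 2) := by gcongr
      _ = B / 2 * (hop (n + 2) * (p (n + 2) ^ 2 + p (n + 3) ^ 2)) := by ring
      _ ≤ B / 2 * (2 * W (n + 2)) := by gcongr
      _ = B * W (n + 2) := by ring
  have hmono (n : ℕ) : W (M + 1) * Real.exp (-(B / hop (M + 1))) ≤
      W (M + 1 + n) * Real.exp (-(B / hop (M + 1 + n))) := by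
    induction n with
    | zero => rfl
    | succ n ih =>
      refine ih.trans ?_
      have h1 := (abs_le.mp (hrel (M + n) (by omega))).1
      have e1 : M + 1 + n = M + n + 1 := by omega
      have e2 : M + 1 + (n + 1) = M + n + 2 := by omega
      rw [e1, e2]
      set ε := B / hop (M + n + 1) - B / hop (M + n + 2)
      have h2 : W (M + n + 1) ≤ W (M + n + 2) * Real.exp ε := by
        have := mul_le_mul_of_nonneg_left (Real.add_one_le_exp ε) (hWpos (M + n + 1)).le
        linarith
      calc W (M + n + 1) * Real.exp (-(B / hop (M + n + 1)))
          ≤ W (M + n + 2) * Real.exp ε * Real.exp (-(B / hop (M + n + 1))) := by gcongr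
        _ = W (M + n + 2) * Real.exp (-(B / hop (M + n + 2))) := by
          rw [mul_assoc, ← Real.exp_add]
          congr 2
          ring
  have hanti (n : ℕ) : W (M + 1 + n) * Real.exp (2 * (B / hop (M + 1 + n))) ≤
      W (M + 1) * Real.exp (2 * (B / hop (M + 1))) := by
    induction n with
    | zero => rfl
    | succ n ih =>
      refine le_trans ?_ ih
      have h1 := (abs_le.mp (hrel (M + n) (by omega))).2
      have e1 : M + 1 + n = M + n + 1 := by omega
      have e2 : M + 1 + (n + 1) = M + n + 2 := by omega
      rw [e1, e2]
      have hc1 := hM (M + n + 1) (by omega)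
      have hc2 := hM (M + n + 2) (by omega)
      set ε := B / hop (M + n + 1) - B / hop (M + n + 2) with hε
      have hε0 : 0 ≤ ε := sub_nonneg.mpr (div_le_div_of_nonneg_left (by linarith)
        (hop_succ_pos _) (hop_monotone (Nat.le_succ _)))
      have hε1 : ε ≤ 1 / 2 := by
        have hc3 := hop_add_two (M + n)
        have hpos := hop_succ_pos (M + n)
        have h5 : B / hop (M + n + 1) - B / hop (M + n + 2) =
            B / hop (M + n + 1) * (1 / 2 / hop (M + n + 2)) := by
          rw [hc3]
          have : hop (M + n + 1) + 1 / 2 ≠ 0 := by positivity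
          field_simp
          ring
        have h6 : B / hop (M + n + 1) ≤ 1 := (div_le_one hpos).mpr hc1
        have h7 : 1 / 2 / hop (M + n + 2) ≤ 1 / 2 :=
          div_le_self (by norm_num) (hB1.trans hc2)
        rw [hε, h5]
        calc B / hop (M + n + 1) * (1 / 2 / hop (M + n + 2)) ≤ 1 * (1 / 2) :=
              mul_le_mul h6 h7 (div_nonneg (by norm_num) (hop_nonneg _)) zero_le_one
          _ = 1 / 2 := one_mul _
      have h2 : W (M + n + 2) ≤ W (M + n + 1) * Real.exp (2 * ε) := by
        have h3 : 1 ≤ (1 - ε) * Real.exp (2 * ε) := by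
          have := mul_le_mul_of_nonneg_left (Real.add_one_le_exp (2 * ε))
            (show 0 ≤ 1 - ε by linarith)
          nlinarith
        calc W (M + n + 2) ≤ W (M + n + 2) * ((1 - ε) * Real.exp (2 * ε)) :=
              le_mul_of_one_le_right (hWpos _).le h3
          _ = (W (M + n + 2) - ε * W (M + n + 2)) * Real.exp (2 * ε) := by ring
          _ ≤ W (M + n + 1) * Real.exp (2 * ε) := by
            gcongr
            linarith
      calc W (M + n + 2) * Real.exp (2 * (B / hop (M + n + 2)))
          ≤ W (M + n + 1) * Real.exp (2 * ε) * Real.exp (2 * (B / hop (M + n + 2))) := by gcongr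
        _ = W (M + n + 1) * Real.exp (2 * (B / hop (M + n + 1))) := by
          rw [mul_assoc, ← Real.exp_add]
          congr 2
          ring
  refine ⟨M + 1, W (M + 1) * Real.exp (-(B / hop (M + 1))) / 2, ?_,
    2 * (W (M + 1) * Real.exp (2 * (B / hop (M + 1)))), ?_, fun n hn => ?_⟩
  · have := hWpos M
    positivity
  · have := hWpos M
    positivity
  obtain ⟨k, rfl⟩ := Nat.exists_eq_add_of_le hn
  have hpos : 0 < W (M + 1 + k) := by
    rw [show M + 1 + k = M + k + 1 by omega]
    exact hWpos _
  have hBc : 0 ≤ B / hop (M + 1 + k) := div_nonneg (by linarith) (hop_nonneg _)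
  have h1 : W (M + 1 + k) * Real.exp (-(B / hop (M + 1 + k))) ≤ W (M + 1 + k) :=
    mul_le_of_le_one_right hpos.le (Real.exp_le_one_iff.mpr (by linarith))
  have h2 : W (M + 1 + k) ≤ W (M + 1 + k) * Real.exp (2 * (B / hop (M + 1 + k))) :=
    le_mul_of_one_le_right hpos.le (Real.one_le_exp (by linarith))
  refine ⟨by linarith [hM (M + 1 + k) (by omega)], ?_, ?_⟩
  · linarith [hmono k, hupp (M + 1 + k) (by omega)]
  · linarith [hanti k, hlow (M + 1 + k) (by omega)]

/-- The formal eigenvalue equation of the Jacobi matrix with zero diagonal and weights `hop`, with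
an inhomogeneity `f`. The level `0` is decoupled from the others. -/
def IsJacobiSolution (z : ℂ) (f q : ℕ → ℂ) : Prop :=
  0 = z * q 0 + f 0 ∧ ∀ n, hop (n + 1) * q (n + 2) + hop n * q n = z * q (n + 1) + f (n + 1)

theorem eq_zero_of_recurrence_of_summable {z : ℝ} {p : ℕ → ℝ}
    (hp : ∀ n, hop (n + 1) * p (n + 2) + hop n * p n = z * p (n + 1))
    (hs : Summable fun n => p n ^ 2) : p 1 = 0 := by
  by_contra hp1
  obtain ⟨N, δ, hδ, C, -, h⟩ := exists_bounds_of_recurrence hp hp1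
  refine not_summable_inv_hop N ?_
  have h1 : Summable fun n => δ⁻¹ * (p (n + N) ^ 2 + p (n + N + 1) ^ 2) := by
    refine Summable.mul_left _ (((summable_nat_add_iff N).mpr hs).add ?_)
    exact (summable_nat_add_iff (N + 1)).mpr hs
  refine Summable.of_nonneg_of_le (fun n => inv_nonneg.mpr (hop_nonneg _)) (fun n => ?_) h1
  obtain ⟨h2, h3, -⟩ := h (n + N) (Nat.le_add_left _ _)
  rw [inv_mul_eq_div, le_div_iff₀ hδ, inv_mul_eq_div, div_le_iff₀ h2]
  linarith

theorem IsJacobiSolution.eq_zero {z : ℂ} {q : ℕ → ℂ} (hz : z ≠ 0) (h : IsJacobiSolution z 0 q)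
    (hs : Summable fun n => ‖q n‖ ^ 2) : q = 0 := by
  obtain ⟨h0, hrec⟩ := h
  have hq0 : q 0 = 0 := by
    simp only [Pi.zero_apply, add_zero] at h0
    exact (mul_eq_zero.mp h0.symm).resolve_left hz
  simp only [Pi.zero_apply, add_zero] at hrec
  have hq1 : q 1 = 0 := by
    by_cases him : z.im = 0
    · obtain ⟨x, rfl⟩ : ∃ x : ℝ, z = x := ⟨z.re, Complex.ext rfl (by simpa using him)⟩
      have hre : (q 1).re = 0 := by
        refine eq_zero_of_recurrence_of_summable (z := x) (p := fun n => (q n).re) (fun n => ?_) ?_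
        · simpa using congrArg Complex.re (hrec n)
        · refine Summable.of_nonneg_of_le (fun n => sq_nonneg _) (fun n => ?_) hs
          rw [← sq_abs]
          gcongr
          exact Complex.abs_re_le_norm _
      have him : (q 1).im = 0 := by
        refine eq_zero_of_recurrence_of_summable (z := x) (p := fun n => (q n).im) (fun n => ?_) ?_
        · simpa using congrArg Complex.im (hrec n)
        · refine Summable.of_nonneg_of_le (fun n => sq_nonneg _) (fun n => ?_) hs
          rw [← sq_abs]
          gcongr
          exact Complex.abs_im_le_norm _
      exact Complex.ext hre him
    · -- the Wronskian of `q` and its conjugate grows, so the entries cannot decay fast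
      by_contra hq1
      have hD (n : ℕ) : z.im ^ 2 * ‖q 1‖ ^ 2 ≤
          z.im * (hop (n + 1) * ((starRingEnd ℂ) (q (n + 1)) * q (n + 2)).im) := by
        have step (n : ℕ) : hop (n + 1) * ((starRingEnd ℂ) (q (n + 1)) * q (n + 2)).im =
            z.im * ‖q (n + 1)‖ ^ 2 + hop n * ((starRingEnd ℂ) (q n) * q (n + 1)).im := by
          have h1 := congrArg (fun w => ((starRingEnd ℂ) (q (n + 1)) * w).im) (hrec n)
          rw [Complex.sq_norm, Complex.normSq_apply]
          simp at h1 ⊢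
          linarith
        induction n with
        | zero => rw [step, hop_zero]; linarith
        | succ n ih =>
          rw [step, mul_add, ← mul_assoc, ← sq]
          have : 0 ≤ z.im ^ 2 * ‖q (n + 2)‖ ^ 2 := by positivity
          linarith
      have hpos : 0 < |z.im| * ‖q 1‖ ^ 2 :=
        mul_pos (abs_pos.mpr him) (pow_pos (norm_pos_iff.mpr hq1) 2)
      have hbd (n : ℕ) : |z.im| * ‖q 1‖ ^ 2 ≤ hop (n + 1) * (‖q (n + 1)‖ * ‖q (n + 2)‖) := by
        refine le_of_mul_le_mul_left ?_ (abs_pos.mpr him)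
        calc |z.im| * (|z.im| * ‖q 1‖ ^ 2) = z.im ^ 2 * ‖q 1‖ ^ 2 := by
              rw [← mul_assoc, abs_mul_abs_self, ← sq]
          _ ≤ _ := hD n
          _ ≤ |z.im| * (hop (n + 1) * ‖(starRingEnd ℂ) (q (n + 1)) * q (n + 2)‖) := by
            refine (le_abs_self _).trans ?_
            rw [abs_mul, abs_mul, abs_of_nonneg (hop_nonneg (n + 1))]
            gcongr
            · exact hop_nonneg _
            · exact Complex.abs_im_le_norm _
          _ = _ := by rw [norm_mul, RCLike.norm_conj]
      refine not_summable_inv_hop 1 ?_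
      have h1 : Summable fun n => (|z.im| * ‖q 1‖ ^ 2)⁻¹ * (‖q (n + 1)‖ ^ 2 + ‖q (n + 2)‖ ^ 2) :=
        (((summable_nat_add_iff 1).mpr hs).add ((summable_nat_add_iff 2).mpr hs)).mul_left _
      refine Summable.of_nonneg_of_le (fun n => inv_nonneg.mpr (hop_nonneg _)) (fun n => ?_) h1
      rw [inv_mul_eq_div, le_div_iff₀ hpos, inv_mul_eq_div, div_le_iff₀ (hop_succ_pos n)]
      refine (hbd n).trans ?_
      rw [mul_comm]
      refine mul_le_mul_of_nonneg_right ?_ (hop_nonneg _)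
      nlinarith [sq_nonneg (‖q (n + 1)‖ - ‖q (n + 2)‖), sq_nonneg ‖q (n + 1)‖, sq_nonneg ‖q (n + 2)‖]
  funext n
  induction n using Nat.twoStepInduction with
  | zero => exact hq0
  | one => exact hq1
  | more n ih ih' =>
    have h1 := hrec n
    rw [ih, ih'] at h1
    simpa [(hop_succ_pos n).ne'] using h1

theorem exists_recurrence (z : ℝ) : ∃ p : ℕ → ℝ, p 0 = 0 ∧ p 1 = 1 ∧
    ∀ n, hop (n + 1) * p (n + 2) + hop n * p n = z * p (n + 1) := by
  let F : ℕ → ℝ × ℝ := fun n => Nat.rec (0, 1)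
    (fun n x => (x.2, (z * x.2 - hop n * x.1) / hop (n + 1))) n
  refine ⟨fun n => (F n).1, rfl, rfl, fun n => ?_⟩
  change hop (n + 1) * ((z * (F n).2 - hop n * (F n).1) / hop (n + 1)) + hop n * (F n).1 =
    z * (F n).2
  rw [mul_div_cancel₀ _ (hop_succ_pos n).ne']
  ring

/-- Real numbers are approximate eigenvalues: the formal eigenvector `p` is damped by the product
`φ n` of the factors `1 - s / c_k`, `k < n`, which makes it square summable and leaves an error of
relative size `s`. -/
theorem exists_approximate_solution (z : ℝ) {s : ℝ} (hs0 : 0 < s) (hs : s ≤ 1 / 2) :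
    ∃ x f : ℕ → ℝ, x 1 ≠ 0 ∧ (Summable fun n => x n ^ 2) ∧ (Summable fun n => f n ^ 2) ∧
      IsJacobiSolution z (fun n => f n) (fun n => x n) ∧
      ∑' n, f n ^ 2 ≤ 10 * s ^ 2 * ∑' n, x n ^ 2 := by
  obtain ⟨p, hp0, hp1, hp⟩ := exists_recurrence z
  obtain ⟨N, δ, hδ, C, hC, hb⟩ := exists_bounds_of_recurrence hp (by rw [hp1]; exact one_ne_zero)
  -- the factor with `k = 0` is `1`, because `hop 0 = 0` and division by zero gives zero
  set φ : ℕ → ℝ := fun n => ∏ k ∈ Finset.range n, (1 - s / hop k) with hφ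
  have hφs (n : ℕ) : φ (n + 1) = φ n * (1 - s / hop n) := Finset.prod_range_succ _ _
  have hφ1 : φ 1 = 1 := by simp [hφ, hop_zero]
  have hsc (n : ℕ) : 0 ≤ s / hop n ∧ s / hop n ≤ 1 / 2 := by
    refine ⟨div_nonneg hs0.le (hop_nonneg n), ?_⟩
    rcases n with _ | n
    · simp [hop_zero]
    · rw [div_le_iff₀ (hop_succ_pos n), hop_succ]
      have : (0 : ℝ) ≤ n := n.cast_nonneg
      linarith
  have hφsq (n : ℕ) : φ n ^ 2 ≤ 4 * φ (n + 1) ^ 2 := by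
    have h1 : (1 / 2 : ℝ) ^ 2 ≤ (1 - s / hop n) ^ 2 :=
      pow_le_pow_left₀ (by norm_num) (by linarith [hsc n]) 2
    rw [hφs, mul_pow]
    nlinarith [sq_nonneg (φ n)]
  -- telescoping: the decrease of `φ n ^ 2` dominates `s * φ n ^ 2 / c_n`
  have htel (n : ℕ) : s * (φ n ^ 2 * (hop n)⁻¹) ≤ φ n ^ 2 - φ (n + 1) ^ 2 := by
    have h1 : φ n ^ 2 - φ (n + 1) ^ 2 = φ n ^ 2 * (s / hop n * (2 - s / hop n)) := by
      rw [hφs]; ring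
    rw [h1, mul_left_comm, ← div_eq_mul_inv]
    exact mul_le_mul_of_nonneg_left (by nlinarith [hsc n]) (sq_nonneg _)
  have hφsum : Summable fun n => s * (φ n ^ 2 * (hop n)⁻¹) := by
    refine summable_of_sum_range_le (c := φ 0 ^ 2)
      (fun n => mul_nonneg hs0.le (mul_nonneg (sq_nonneg _) (inv_nonneg.mpr (hop_nonneg n))))
      fun n => ?_
    calc ∑ i ∈ Finset.range n, s * (φ i ^ 2 * (hop i)⁻¹)
        ≤ ∑ i ∈ Finset.range n, (φ i ^ 2 - φ (i + 1) ^ 2) := Finset.sum_le_sum fun i _ => htel i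
      _ = φ 0 ^ 2 - φ n ^ 2 := Finset.sum_range_sub' (fun i => φ i ^ 2) n
      _ ≤ φ 0 ^ 2 := by linarith [sq_nonneg (φ n)]
  set x : ℕ → ℝ := fun n => φ n * p n with hx
  have hxsum : Summable fun n => x n ^ 2 := by
    refine (summable_nat_add_iff N).mp ?_
    refine Summable.of_nonneg_of_le (fun n => sq_nonneg _) (fun n => ?_)
      (((summable_nat_add_iff N).mpr hφsum).mul_left (C / s))
    obtain ⟨h1, -, h3⟩ := hb (n + N) (Nat.le_add_left _ _)
    have h4 : p (n + N) ^ 2 ≤ C * (hop (n + N))⁻¹ := by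
      rw [← div_eq_mul_inv, le_div_iff₀ h1]
      nlinarith [sq_nonneg (p (n + N + 1))]
    calc x (n + N) ^ 2 = φ (n + N) ^ 2 * p (n + N) ^ 2 := mul_pow _ _ _
      _ ≤ φ (n + N) ^ 2 * (C * (hop (n + N))⁻¹) := by gcongr
      _ = C / s * (s * (φ (n + N) ^ 2 * (hop (n + N))⁻¹)) := by field_simp
  set g : ℕ → ℝ := fun n =>
    if n = 0 then 0 else s * (φ (n - 1) * p (n - 1) - φ n * p (n + 1)) with hg
  have hgle (n : ℕ) : g (n + 1) ^ 2 ≤ 2 * s ^ 2 * (x n ^ 2 + 4 * x (n + 2) ^ 2) := by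
    have e : g (n + 1) = s * (x n - φ (n + 1) * p (n + 2)) := by
      simp [hg, hx]
    have h1 := mul_le_mul_of_nonneg_right (hφsq (n + 1)) (sq_nonneg (p (n + 2)))
    have h2 : 0 ≤ (x n + φ (n + 1) * p (n + 2)) ^ 2 := sq_nonneg _
    rw [e, mul_pow, mul_comm 2 (s ^ 2), mul_assoc]
    refine mul_le_mul_of_nonneg_left ?_ (sq_nonneg s)
    have h3 : x (n + 2) ^ 2 = φ (n + 2) ^ 2 * p (n + 2) ^ 2 := mul_pow _ _ _
    rw [h3]
    linarith
  have hx2 : Summable fun n => x (n + 2) ^ 2 := (summable_nat_add_iff 2).mpr hxsum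
  have hmaj : Summable fun n => 2 * s ^ 2 * (x n ^ 2 + 4 * x (n + 2) ^ 2) :=
    (hxsum.add (hx2.mul_left 4)).mul_left _
  have hg1 : Summable fun n => g (n + 1) ^ 2 :=
    Summable.of_nonneg_of_le (fun n => sq_nonneg _) hgle hmaj
  have hgsum : Summable fun n => g n ^ 2 := (summable_nat_add_iff 1).mp hg1
  refine ⟨x, g, ?_, hxsum, hgsum, ⟨?_, fun n => ?_⟩, ?_⟩
  · simp [hx, hφ1, hp1]
  · simp [hx, hp0, hg]
  · have e : g (n + 1) = s * (φ n * p n - φ (n + 1) * p (n + 2)) := by simp [hg]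
    have h1 : hop (n + 1) * x (n + 2) + hop n * x n = z * x (n + 1) + g (n + 1) := by
      rw [e]
      simp only [hx]
      have h2 : hop (n + 1) * φ (n + 2) = hop (n + 1) * φ (n + 1) - s * φ (n + 1) := by
        have := (hop_succ_pos n).ne'
        rw [hφs (n + 1)]
        field_simp
      have h3 : hop n * φ (n + 1) * p n = (hop n * φ n - s * φ n) * p n := by
        rcases n with _ | n
        · -- the cut link is harmless: `p` vanishes at level `0`
          simp [hp0]
        · have := (hop_succ_pos n).ne'
          rw [hφs (n + 1)]
          field_simp
      linear_combination φ (n + 1) * hp n + p (n + 2) * h2 - h3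
    beta_reduce
    exact_mod_cast h1
  · have h0 : g 0 = 0 := if_pos rfl
    have h1 : ∑' n, x (n + 2) ^ 2 ≤ ∑' n, x n ^ 2 := by
      rw [← hxsum.sum_add_tsum_nat_add 2]
      exact le_add_of_nonneg_left (Finset.sum_nonneg fun i _ => sq_nonneg _)
    calc ∑' n, g n ^ 2 = ∑' n, g (n + 1) ^ 2 := by
          rw [hgsum.tsum_eq_zero_add, h0]
          ring
      _ ≤ ∑' n, 2 * s ^ 2 * (x n ^ 2 + 4 * x (n + 2) ^ 2) := hg1.tsum_le_tsum hgle hmaj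
      _ = 2 * s ^ 2 * (∑' n, x n ^ 2 + 4 * ∑' n, x (n + 2) ^ 2) := by
        rw [tsum_mul_left, hxsum.tsum_add (hx2.mul_left 4), tsum_mul_left]
      _ ≤ 2 * s ^ 2 * (∑' n, x n ^ 2 + 4 * ∑' n, x n ^ 2) := by gcongr
      _ = 10 * s ^ 2 * ∑' n, x n ^ 2 := by ring

end OneLoop

/-! ### Closed symmetric operators -/

theorem LinearPMap.IsFormalAdjoint.closure_left {E F : Type*} [NormedAddCommGroup E]
    [InnerProductSpace ℂ E] [NormedAddCommGroup F] [InnerProductSpace ℂ F]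
    {A : E →ₗ.[ℂ] F} {B : F →ₗ.[ℂ] E} (h : A.IsFormalAdjoint B) (hA : A.IsClosable) :
    A.closure.IsFormalAdjoint B := by
  intro x y
  have hx : ((x : E), A.closure x) ∈ _root_.closure (A.graph : Set (E × F)) := by
    rw [← Submodule.topologicalClosure_coe, hA.graph_closure_eq_closure_graph]
    exact A.closure.mem_graph x
  have hcl : _root_.IsClosed {p : E × F | inner ℂ p.2 (y : F) = inner ℂ p.1 (B y)} :=
    isClosed_eq (by fun_prop) (by fun_prop)
  refine closure_minimal (t := {p : E × F | inner ℂ p.2 (y : F) = inner ℂ p.1 (B y)})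
    (fun p hp => ?_) hcl hx
  obtain ⟨u, hu1, hu2⟩ := LinearPMap.mem_graph_iff _ |>.mp hp
  change inner ℂ p.2 (y : F) = inner ℂ p.1 (B y)
  rw [← hu1, ← hu2]
  exact h u y

namespace OneLoop

theorem isFormalAdjoint_smul_sub_adjoint {E : Type*} [NormedAddCommGroup E]
    [InnerProductSpace ℂ E] [CompleteSpace E] {T : E →ₗ.[ℂ] E} (hT : Dense (T.domain : Set E)) :
    ((-Complex.I / 2) • (T - T.adjoint)).IsFormalAdjoint ((-Complex.I / 2) • (T - T.adjoint)) := by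
  intro x y
  obtain ⟨x, hx1, hx2⟩ := x
  obtain ⟨y, hy1, hy2⟩ := y
  have ha := LinearPMap.adjoint_isFormalAdjoint hT
  have h1 : inner ℂ (T.adjoint ⟨x, hx2⟩) y = inner ℂ x (T ⟨y, hy1⟩) := ha ⟨x, hx2⟩ ⟨y, hy1⟩
  have h2 : inner ℂ (T ⟨x, hx1⟩) y = inner ℂ x (T.adjoint ⟨y, hy2⟩) := ha.symm ⟨x, hx1⟩ ⟨y, hy2⟩
  change inner ℂ ((-Complex.I / 2) • (T ⟨x, hx1⟩ - T.adjoint ⟨x, hx2⟩)) y =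
    inner ℂ x ((-Complex.I / 2) • (T ⟨y, hy1⟩ - T.adjoint ⟨y, hy2⟩))
  rw [inner_smul_left, inner_smul_right, inner_sub_left, inner_sub_right, h1, h2]
  simp only [map_div₀, map_neg, Complex.conj_I, Complex.conj_ofNat]
  ring

theorem im_mul_norm_le_of_isFormalAdjoint {E : Type*} [NormedAddCommGroup E]
    [InnerProductSpace ℂ E] {T : E →ₗ.[ℂ] E} (hsym : T.IsFormalAdjoint T) (z : ℂ) (x : T.domain) :
    |z.im| * ‖(x : E)‖ ≤ ‖T x - z • (x : E)‖ := by
  rcases eq_or_ne (x : E) 0 with hx | hx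
  · rw [hx, norm_zero, mul_zero]
    exact norm_nonneg _
  refine le_of_mul_le_mul_right ?_ (norm_pos_iff.mpr hx)
  have hreal : (inner ℂ (x : E) (T x)).im = 0 := by
    rw [← Complex.conj_eq_iff_im, inner_conj_symm]
    exact hsym x x
  have him : (inner ℂ (x : E) (T x - z • (x : E))).im = -(z.im * ‖(x : E)‖ ^ 2) := by
    rw [inner_sub_right, inner_smul_right, inner_self_eq_norm_sq_to_K, Complex.sub_im, hreal]
    simp [← Complex.ofReal_pow]
  calc |z.im| * ‖(x : E)‖ * ‖(x : E)‖ = |(inner ℂ (x : E) (T x - z • (x : E))).im| := by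
        rw [him, abs_neg, abs_mul, abs_of_nonneg (sq_nonneg ‖(x : E)‖)]
        ring
    _ ≤ ‖inner ℂ (x : E) (T x - z • (x : E))‖ := Complex.abs_im_le_norm _
    _ ≤ ‖(x : E)‖ * ‖T x - z • (x : E)‖ := norm_inner_le_norm _ _
    _ = ‖T x - z • (x : E)‖ * ‖(x : E)‖ := mul_comm _ _

/-- A non-real number is a regular value of a closed symmetric operator once the deficiency space
at that number is trivial. -/
theorem isRegularValue_of_isFormalAdjoint {E : Type*} [NormedAddCommGroup E]
    [InnerProductSpace ℂ E] [CompleteSpace E] {T : E →ₗ.[ℂ] E} (hT : T.IsClosed)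
    (hsym : T.IsFormalAdjoint T) {z : ℂ} (hz : z.im ≠ 0)
    (hdef : ∀ y : E, (∀ x : T.domain, inner ℂ (T x - z • (x : E)) y = 0) → y = 0) :
    IsRegularValue T z := by
  have hc : CompleteSpace T.graph := IsClosed.completeSpace_coe (hs := hT)
  let A : T.graph →L[ℂ] E :=
    (ContinuousLinearMap.snd ℂ E E - z • ContinuousLinearMap.fst ℂ E E).comp T.graph.subtypeL
  have hA (p : T.graph) : A p = p.1.2 - z • p.1.1 := rfl
  have hzpos : 0 < |z.im| := abs_pos.mpr hz
  have hbound (p : T.graph) :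
      ‖p‖ ≤ (|z.im|⁻¹ + (1 + ‖z‖ * |z.im|⁻¹)).toNNReal * ‖A p‖ := by
    obtain ⟨x, hx1, hx2⟩ := LinearPMap.mem_graph_iff _ |>.mp p.2
    have h1 : ‖p.1.1‖ ≤ |z.im|⁻¹ * ‖A p‖ := by
      have := im_mul_norm_le_of_isFormalAdjoint hsym z x
      rw [hx1, hx2, ← hA] at this
      rwa [inv_mul_eq_div, le_div_iff₀' hzpos]
    have h2 : ‖p.1.2‖ ≤ (1 + ‖z‖ * |z.im|⁻¹) * ‖A p‖ := by
      calc ‖p.1.2‖ = ‖A p + z • p.1.1‖ := by rw [hA, sub_add_cancel]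
        _ ≤ ‖A p‖ + ‖z‖ * ‖p.1.1‖ := (norm_add_le _ _).trans_eq (by rw [norm_smul])
        _ ≤ ‖A p‖ + ‖z‖ * (|z.im|⁻¹ * ‖A p‖) := by gcongr
        _ = _ := by ring
    rw [Real.coe_toNNReal _ (by positivity), add_mul]
    refine max_le (h1.trans (le_add_of_nonneg_right (by positivity)))
      (h2.trans (le_add_of_nonneg_left (by positivity)))
  have hanti := A.antilipschitz_of_bound hbound
  have hclosed : IsClosed (LinearMap.range A.toLinearMap : Set E) := by
    exact hanti.isClosed_range A.uniformContinuous
  have hker : LinearMap.ker A.toLinearMap = ⊥ := LinearMap.ker_eq_bot.mpr hanti.injective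
  have hrange : LinearMap.range A.toLinearMap = ⊤ := by
    have : CompleteSpace (LinearMap.range A.toLinearMap) := hclosed.completeSpace_coe
    rw [← Submodule.orthogonal_eq_bot_iff, Submodule.eq_bot_iff]
    intro y hy
    refine hdef y fun x => ?_
    exact (Submodule.mem_orthogonal _ y).mp hy _ ⟨⟨((x : E), T x), T.mem_graph x⟩, rfl⟩
  let e := ContinuousLinearEquiv.ofBijective A hker hrange
  refine ⟨((ContinuousLinearMap.fst ℂ E E).comp T.graph.subtypeL).comp
    (e.symm : E →L[ℂ] T.graph), fun x => ?_, fun y => ?_⟩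
  · have h1 : e.symm (T x - z • (x : E)) = ⟨((x : E), T x), T.mem_graph x⟩ :=
      e.symm_apply_eq.mpr rfl
    change (e.symm (T x - z • (x : E))).1.1 = x
    rw [h1]
  · obtain ⟨x, hx1, hx2⟩ := LinearPMap.mem_graph_iff _ |>.mp (e.symm y).2
    refine ⟨x, hx1, ?_⟩
    rw [hx1, hx2]
    exact e.apply_symm_apply y

/-! ### The Euclidean operator, its adjoint and `H_I` in an orthonormal basis -/

variable {E : Type*} [NormedAddCommGroup E] [InnerProductSpace ℂ E]

/-- The image of `e n` under the Euclidean operator in terms of the sequence `e`. -/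
noncomputable def euclidVec (e : ℕ → E) : ℕ → E
  | 0 => 0
  | n + 1 => ((n + 4) / 2 : ℂ) • e (n + 2) - (n / 2 : ℂ) • e n

/-- The image of `e n` under the adjoint of the Euclidean operator in terms of the sequence `e`. -/
noncomputable def euclidAdjointVec (e : ℕ → E) : ℕ → E
  | 0 => 0
  | n + 1 => (if n = 0 then 0 else (n + 3) / 2 : ℂ) • e n - ((n + 1) / 2 : ℂ) • e (n + 2)

/-- The image of `e n` under `H_I` in terms of the sequence `e`. -/
noncomputable def hamiltonianVec (e : ℕ → E) : ℕ → E
  | 0 => 0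
  | n + 1 => (-Complex.I * hop (n + 1)) • e (n + 2) + (Complex.I * hop n) • e n

theorem inner_euclidAdjointVec {e : ℕ → E} (he : Orthonormal ℂ e) (m n : ℕ) :
    inner ℂ (euclidAdjointVec e m) (e n) = inner ℂ (e m) (euclidVec e n) := by
  have h2 : (starRingEnd ℂ) 2 = 2 := Complex.conj_ofNat 2
  have h3 : (starRingEnd ℂ) 3 = 3 := Complex.conj_ofNat 3
  rcases m with _ | _ | m <;> rcases n with _ | n <;>
    simp only [euclidVec, euclidAdjointVec, inner_zero_left, inner_zero_right, inner_sub_left,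
      inner_sub_right, inner_smul_left, inner_smul_right, orthonormal_iff_ite.mp he] <;>
    simp [h2, h3]
  · exact Eq.symm
  all_goals split_ifs <;> first | omega | (subst_vars; push_cast; ring)

theorem smul_euclidVec_sub_euclidAdjointVec (e : ℕ → E) (n : ℕ) :
    (-Complex.I / 2) • (euclidVec e n - euclidAdjointVec e n) = hamiltonianVec e n := by
  rcases n with _ | _ | n
  · simp [euclidVec, euclidAdjointVec, hamiltonianVec]
  · simp [euclidVec, euclidAdjointVec, hamiltonianVec, hop_succ, hop_zero]
    module
  · simp only [euclidVec, euclidAdjointVec, hamiltonianVec, hop_succ]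
    rw [if_neg n.succ_ne_zero]
    push_cast
    module

theorem isJacobiSolution_iff_inner_hamiltonianVec (e : ℕ → E) (z : ℂ) (f x : E) :
    (∀ n, inner ℂ (hamiltonianVec e n) x = z * inner ℂ (e n) x + inner ℂ (e n) f) ↔
      IsJacobiSolution z (fun n => Complex.I ^ n * inner ℂ (e n) f)
        (fun n => Complex.I ^ n * inner ℂ (e n) x) := by
  have hstep (n : ℕ) : Complex.I ^ (n + 1) * inner ℂ (hamiltonianVec e (n + 1)) x =
      hop (n + 1) * (Complex.I ^ (n + 2) * inner ℂ (e (n + 2)) x) +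
        hop n * (Complex.I ^ n * inner ℂ (e n) x) := by
    simp only [hamiltonianVec, inner_add_left, inner_smul_left, map_mul, map_neg, Complex.conj_I,
      Complex.conj_ofReal]
    linear_combination (-(Complex.I ^ n * hop n * inner ℂ (e n) x)) * Complex.I_sq
  have hI (n : ℕ) : Complex.I ^ n ≠ 0 := pow_ne_zero n Complex.I_ne_zero
  constructor
  · refine fun h => ⟨?_, fun n => ?_⟩
    · simpa [hamiltonianVec] using h 0
    · rw [← hstep, h]
      ring
  · rintro ⟨h0, h⟩ n
    rcases n with _ | n
    · simpa [hamiltonianVec] using h0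
    · refine mul_left_cancel₀ (hI (n + 1)) ?_
      rw [hstep, h]
      ring

theorem hasSum_norm_sq_inner (b : HilbertBasis ℕ ℂ E) (x : E) :
    HasSum (fun n => ‖inner ℂ (b n) x‖ ^ 2) (‖x‖ ^ 2) := by
  have h := lp.hasSum_norm (p := 2) (by norm_num) (b.repr x)
  simpa [b.repr_apply_apply] using h

theorem exists_inner_eq (b : HilbertBasis ℕ ℂ E) {a : ℕ → ℂ} (ha : Summable fun n => ‖a n‖ ^ 2) :
    ∃ x : E, ∀ n, inner ℂ (b n) x = a n := by
  have h : Memℓp a 2 := memℓp_gen (by simpa using ha)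
  refine ⟨b.repr.symm ⟨a, h⟩, fun n => ?_⟩
  rw [← b.repr_apply_apply, LinearIsometryEquiv.apply_symm_apply]

theorem eq_zero_of_inner_hamiltonianVec (b : HilbertBasis ℕ ℂ E) {z : ℂ} (hz : z ≠ 0) {x : E}
    (h : ∀ n, inner ℂ (hamiltonianVec b n) x = z * inner ℂ (b n) x) : x = 0 := by
  have h1 := (isJacobiSolution_iff_inner_hamiltonianVec b z 0 x).mp fun n => by simpa using h n
  simp only [inner_zero_right, mul_zero] at h1
  have h2 := h1.eq_zero hz (by simpa using (hasSum_norm_sq_inner b x).summable)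
  have h3 (n : ℕ) : inner ℂ (b n) x = 0 := by
    simpa using congrFun h2 n
  have h4 := hasSum_norm_sq_inner b x
  simp only [h3, norm_zero, zero_pow two_ne_zero] at h4
  simpa using h4.unique hasSum_zero

variable {H : E →ₗ.[ℂ] E} {b : HilbertBasis ℕ ℂ E}

theorem inner_hamiltonianVec_closure (hsym : H.IsFormalAdjoint H) (hcl : H.IsClosable)
    (hb : ∀ n, ∃ h : b n ∈ H.domain, H ⟨b n, h⟩ = hamiltonianVec b n) (x : H.closure.domain)
    (n : ℕ) : inner ℂ (hamiltonianVec b n) (x : E) = inner ℂ (b n) (H.closure x) := by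
  obtain ⟨h, e⟩ := hb n
  rw [← e]
  exact (hsym.closure_left hcl).symm ⟨b n, h⟩ x

theorem isRegularValue_closure_of_im_ne_zero [CompleteSpace E] (hsym : H.IsFormalAdjoint H) (hcl : H.IsClosable)
    (hb : ∀ n, ∃ h : b n ∈ H.domain, H ⟨b n, h⟩ = hamiltonianVec b n) {z : ℂ} (hz : z.im ≠ 0) :
    IsRegularValue H.closure z := by
  have h1 := hsym.closure_left hcl
  refine isRegularValue_of_isFormalAdjoint hcl.closure_isClosed (h1.symm.closure_left hcl) hz
    fun y hy => ?_
  refine eq_zero_of_inner_hamiltonianVec b (z := (starRingEnd ℂ) z) ?_ fun n => ?_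
  · intro h0
    apply hz
    rw [(map_eq_zero _).mp h0, Complex.zero_im]
  · obtain ⟨h, e⟩ := hb n
    have h2 := hy ⟨b n, H.le_closure.1 h⟩
    rw [← H.le_closure.2 (x := ⟨b n, h⟩) (y := ⟨b n, H.le_closure.1 h⟩) rfl, e, inner_sub_left,
      inner_smul_left, sub_eq_zero] at h2
    exact h2

/-- The approximate eigenvectors are mapped by `H - z` to small vectors, and a bounded inverse of
`H - z` would map these back to the approximate eigenvectors, by uniqueness of square summable
solutions of the recurrence. -/
theorem not_isRegularValue_closure_ofReal (hsym : H.IsFormalAdjoint H) (hcl : H.IsClosable)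
    (hb : ∀ n, ∃ h : b n ∈ H.domain, H ⟨b n, h⟩ = hamiltonianVec b n) {r : ℝ} (hr : r ≠ 0) :
    ¬ IsRegularValue H.closure r := by
  rintro ⟨R, -, hR⟩
  obtain ⟨s, hs0, hs1, hs2⟩ : ∃ s : ℝ, 0 < s ∧ s ≤ 1 / 2 ∧ s * (4 * (‖R‖ + 1)) ≤ 1 := by
    refine ⟨(4 * (‖R‖ + 1))⁻¹, by positivity, ?_, (inv_mul_cancel₀ (by positivity)).le⟩
    rw [inv_le_comm₀ (by positivity) (by norm_num)]
    linarith [norm_nonneg R]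
  obtain ⟨a, g, ha1, ha, hg, hsol, hle⟩ := exists_approximate_solution r hs0 hs1
  have hI (n : ℕ) (t : ℝ) : ‖(-Complex.I) ^ n * (t : ℂ)‖ ^ 2 = t ^ 2 := by simp
  obtain ⟨x, hx⟩ := exists_inner_eq b (a := fun n => (-Complex.I) ^ n * (a n : ℂ))
    (by simpa only [hI] using ha)
  obtain ⟨f, hf⟩ := exists_inner_eq b (a := fun n => (-Complex.I) ^ n * (g n : ℂ))
    (by simpa only [hI] using hg)
  have hxn : ‖x‖ ^ 2 = ∑' n, a n ^ 2 := by
    rw [← (hasSum_norm_sq_inner b x).tsum_eq]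
    simp only [hx, hI]
  have hfn : ‖f‖ ^ 2 = ∑' n, g n ^ 2 := by
    rw [← (hasSum_norm_sq_inner b f).tsum_eq]
    simp only [hf, hI]
  have hx0 : x ≠ 0 := by
    rintro rfl
    have := hx 1
    simp [ha1] at this
  have hxf : ∀ n, inner ℂ (hamiltonianVec b n) x = r * inner ℂ (b n) x + inner ℂ (b n) f := by
    rw [isJacobiSolution_iff_inner_hamiltonianVec]
    convert! hsol using 2 with n n
    · rw [hf, ← mul_assoc, ← mul_pow]
      simp
    · rw [hx, ← mul_assoc, ← mul_pow]
      simp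
  obtain ⟨w, hw1, hw2⟩ := hR f
  have hxw : x - R f = 0 := by
    refine eq_zero_of_inner_hamiltonianVec b (z := r) (by exact_mod_cast hr) fun n => ?_
    have h1 := inner_hamiltonianVec_closure hsym hcl hb w n
    rw [eq_add_of_sub_eq hw2, inner_add_right, inner_smul_right, hw1] at h1
    rw [inner_sub_right, inner_sub_right, hxf, h1]
    ring
  have h1 : ‖x‖ ≤ ‖R‖ * ‖f‖ := by
    rw [sub_eq_zero.mp hxw]
    exact R.le_opNorm f
  have h2 : ‖f‖ ≤ 4 * s * ‖x‖ := by
    refine abs_le_of_sq_le_sq' ?_ (by positivity) |>.2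
    rw [hfn, mul_pow, hxn]
    refine hle.trans (mul_le_mul_of_nonneg_right ?_ (tsum_nonneg fun n => sq_nonneg _))
    nlinarith [sq_nonneg s]
  have hxpos : 0 < ‖x‖ := norm_pos_iff.mpr hx0
  have h3 : ‖x‖ ≤ ‖R‖ * (4 * s) * ‖x‖ := by
    calc ‖x‖ ≤ ‖R‖ * ‖f‖ := h1
      _ ≤ ‖R‖ * (4 * s * ‖x‖) := by gcongr
      _ = _ := by ring
  have h4 : 1 ≤ ‖R‖ * (4 * s) := by
    refine le_of_mul_le_mul_right ?_ hxpos
    rwa [one_mul]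
  nlinarith

theorem exists_closure_apply_basis_zero
    (hb : ∀ n, ∃ h : b n ∈ H.domain, H ⟨b n, h⟩ = hamiltonianVec b n) :
    ∃ h : b 0 ∈ H.closure.domain, H.closure ⟨b 0, h⟩ = 0 := by
  obtain ⟨h, e⟩ := hb 0
  refine ⟨H.le_closure.1 h, ?_⟩
  rw [← H.le_closure.2 (x := ⟨b 0, h⟩) (y := ⟨b 0, H.le_closure.1 h⟩) rfl, e]
  rfl

theorem pointSpectrum_closure (hsym : H.IsFormalAdjoint H) (hcl : H.IsClosable)
    (hb : ∀ n, ∃ h : b n ∈ H.domain, H ⟨b n, h⟩ = hamiltonianVec b n) :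
    pointSpectrum H.closure = {0} := by
  ext z
  constructor
  · rintro ⟨x, hx0, hx⟩
    by_contra hz
    refine hx0 (eq_zero_of_inner_hamiltonianVec b hz fun n => ?_)
    rw [inner_hamiltonianVec_closure hsym hcl hb x n, hx, inner_smul_right]
  · rintro rfl
    obtain ⟨h, e⟩ := exists_closure_apply_basis_zero hb
    exact ⟨⟨b 0, h⟩, b.orthonormal.ne_zero 0, by rw [e, zero_smul]⟩

theorem unboundedSpectrum_closure [CompleteSpace E] (hsym : H.IsFormalAdjoint H) (hcl : H.IsClosable)
    (hb : ∀ n, ∃ h : b n ∈ H.domain, H ⟨b n, h⟩ = hamiltonianVec b n) :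
    unboundedSpectrum H.closure = Set.range ((↑) : ℝ → ℂ) := by
  ext z
  constructor
  · intro hz
    by_contra hzr
    refine hz (isRegularValue_closure_of_im_ne_zero hsym hcl hb fun him => hzr ⟨z.re, ?_⟩)
    exact Complex.ext rfl (by simpa using him.symm)
  · rintro ⟨r, rfl⟩
    rcases eq_or_ne r 0 with rfl | hr
    · rintro ⟨R, hR, -⟩
      obtain ⟨h, e⟩ := exists_closure_apply_basis_zero hb
      have h1 := hR ⟨b 0, h⟩
      rw [e] at h1
      exact b.orthonormal.ne_zero 0 (by simpa using h1.symm)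
    · exact not_isRegularValue_closure_ofReal hsym hcl hb hr

end OneLoop

namespace OneLoop

/-! ### The operators `K` and `H_I` -/

theorem coeFn_spinVec (n : ℕ) : (spinVec n : SU2 → ℂ) =ᵐ[haarSU2] spinNet n :=
  ContinuousMap.coeFn_toLp (p := 2) (𝕜 := ℂ) haarSU2 ⟨spinNet n, continuous_spinNet n⟩

theorem coeFn_euclidVec_ket {n : ℕ} (hn : n ≠ 0) :
    ((euclidVec ket n : Hloop) : Kin) =ᵐ[haarSU2] euclid (spinNet n) := by
  obtain ⟨n, rfl⟩ := Nat.exists_eq_succ_of_ne_zero hn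
  have hcoe : ((euclidVec ket (n + 1) : Hloop) : Kin) =
      ((n + 4) / 2 : ℂ) • spinVec (n + 2) - (n / 2 : ℂ) • spinVec n := rfl
  rw [Nat.succ_eq_add_one, hcoe]
  filter_upwards [Lp.coeFn_sub (((n + 4) / 2 : ℂ) • spinVec (n + 2)) ((n / 2 : ℂ) • spinVec n),
    Lp.coeFn_smul ((n + 4) / 2 : ℂ) (spinVec (n + 2)), Lp.coeFn_smul (n / 2 : ℂ) (spinVec n),
    coeFn_spinVec (n + 2), coeFn_spinVec n] with h h1 h2 h3 h4 h5
  have e : (((n + 1 : ℕ) : ℤ) - 1) = (n : ℤ) := by push_cast; ring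
  rw [h1, Pi.sub_apply, h2, h3, Pi.smul_apply, Pi.smul_apply, h4, h5, euclid_spinNet, e,
    ← spinNet_eq_eval, smul_eq_mul, smul_eq_mul]
  push_cast
  ring

/-- The generating pairs of the graph of `K` are the pairs `(|j⟩, K|j⟩)`. -/
theorem graph_generators_eq : {p : Hloop × Hloop | p = (ket 0, 0) ∨
    ∃ n : ℕ, n ≠ 0 ∧ p.1 = ket n ∧
      ((p.2 : Kin) : SU2 → ℂ) =ᵐ[haarSU2] euclid (spinNet n)} =
    Set.range fun n => (ket n, euclidVec ket n) := by
  ext p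
  constructor
  · rintro (rfl | ⟨n, hn, h1, h2⟩)
    · exact ⟨0, rfl⟩
    · exact ⟨n, Prod.ext h1.symm
        (Subtype.ext (Lp.ext ((coeFn_euclidVec_ket hn).trans h2.symm)))⟩
  · rintro ⟨n, rfl⟩
    rcases eq_or_ne n 0 with rfl | hn
    · exact Or.inl rfl
    · exact Or.inr ⟨n, hn, rfl, coeFn_euclidVec_ket hn⟩

theorem K_eq : K = (Submodule.span ℂ
    (Set.range fun n => (ket n, euclidVec ket n))).toLinearPMap := by
  rw [K, graph_generators_eq]

theorem K_domain : K.domain = finiteStates := by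
  rw [K_eq, Submodule.toLinearPMap_domain, Submodule.map_span, ← Set.range_comp]
  rfl

/-- The candidate for the adjoint is adjoint to every pair in the span that defines `K`. Hence the
span is a graph, and the candidate is the adjoint. -/
theorem inner_ket_eq_of_mem_graph {p : Hloop × Hloop}
    (hp : p ∈ Submodule.span ℂ (Set.range fun n => (ket n, euclidVec ket n))) (m : ℕ) :
    inner ℂ (euclidAdjointVec ket m) p.1 = inner ℂ (ket m) p.2 := by
  induction hp using Submodule.span_induction with
  | mem x hx =>
    obtain ⟨n, rfl⟩ := hx
    exact inner_euclidAdjointVec orthonormal_ket m n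
  | zero => simp only [Prod.fst_zero, Prod.snd_zero, inner_zero_right]
  | add x y _ _ hx hy => rw [Prod.fst_add, Prod.snd_add, inner_add_right, inner_add_right, hx, hy]
  | smul a x _ hx => rw [Prod.smul_fst, Prod.smul_snd, inner_smul_right, inner_smul_right, hx]

theorem K_graph : K.graph = Submodule.span ℂ (Set.range fun n => (ket n, euclidVec ket n)) := by
  rw [K_eq]
  refine Submodule.toLinearPMap_graph_eq _ fun p hp hp1 => ?_
  have h1 (m : ℕ) : inner ℂ (ketBasis m) p.2 = 0 := by
    rw [ketBasis_apply, ← inner_ket_eq_of_mem_graph hp m, hp1, inner_zero_right]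
  have h2 := hasSum_norm_sq_inner ketBasis p.2
  simp only [h1, norm_zero, zero_pow two_ne_zero] at h2
  simpa using h2.unique hasSum_zero

theorem exists_K_apply_ket (n : ℕ) : ∃ h : ket n ∈ K.domain, K ⟨ket n, h⟩ = euclidVec ket n := by
  have h : (ket n, euclidVec ket n) ∈ K.graph := by
    rw [K_graph]
    exact Submodule.subset_span ⟨n, rfl⟩
  obtain ⟨⟨x, hx⟩, h1, h2⟩ := (LinearPMap.mem_graph_iff _).mp h
  cases h1
  exact ⟨hx, h2⟩

theorem dense_K_domain : Dense (K.domain : Set Hloop) := by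
  rw [K_domain]
  exact dense_finiteStates

theorem exists_K_adjoint_apply_ket (n : ℕ) :
    ∃ h : ket n ∈ K.adjoint.domain, K.adjoint ⟨ket n, h⟩ = euclidAdjointVec ket n := by
  have h1 (x : K.domain) :
      inner ℂ (euclidAdjointVec ket n) (x : Hloop) = inner ℂ (ket n) (K x) := by
    have h2 := K.mem_graph x
    rw [K_graph] at h2
    exact inner_ket_eq_of_mem_graph h2 n
  exact ⟨LinearPMap.mem_adjoint_domain_of_exists _ ⟨_, h1⟩,
    LinearPMap.adjoint_apply_eq dense_K_domain _ h1⟩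

theorem HI_domain : HI.domain = finiteStates := by
  change K.domain ⊓ K.adjoint.domain = finiteStates
  rw [K_domain, inf_eq_left, finiteStates, Submodule.span_le]
  rintro _ ⟨n, rfl⟩
  exact (exists_K_adjoint_apply_ket n).1

theorem exists_HI_apply_ketBasis (n : ℕ) :
    ∃ h : ketBasis n ∈ HI.domain, HI ⟨ketBasis n, h⟩ = hamiltonianVec ketBasis n := by
  have hb : (ketBasis : ℕ → Hloop) = ket := funext ketBasis_apply
  rw [hb]
  obtain ⟨h1, e1⟩ := exists_K_apply_ket n
  obtain ⟨h2, e2⟩ := exists_K_adjoint_apply_ket n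
  refine ⟨⟨h1, h2⟩, ?_⟩
  rw [← smul_euclidVec_sub_euclidAdjointVec, ← e1, ← e2]
  rfl

theorem HI_isFormalAdjoint : HI.IsFormalAdjoint HI :=
  isFormalAdjoint_smul_sub_adjoint dense_K_domain

theorem dense_HI_domain : Dense (HI.domain : Set Hloop) := by
  rw [HI_domain]
  exact dense_finiteStates

theorem HI_isClosable : HI.IsClosable :=
  (LinearPMap.adjoint_isClosed dense_HI_domain).isClosable.leIsClosable
    (HI_isFormalAdjoint.le_adjoint dense_HI_domain)

end OneLoop

theorem mainTheorem1 :
    -- `H_I` is a symmetric operator with dense domain `𝓕`, hence closable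
    OneLoop.HI.domain = OneLoop.finiteStates ∧
    Dense (OneLoop.finiteStates : Set OneLoop.Hloop) ∧
    OneLoop.HI.IsFormalAdjoint OneLoop.HI ∧
    OneLoop.HI.IsClosable ∧
    -- the spectrum of the closure is the real line
    OneLoop.unboundedSpectrum OneLoop.HI.closure = Set.range ((↑) : ℝ → ℂ) ∧
    -- `|j = 0⟩` is an eigenvector with eigenvalue `0`, and `0` is the only eigenvalue
    (OneLoop.ket 0 ≠ 0 ∧
      ∃ h : OneLoop.ket 0 ∈ OneLoop.HI.closure.domain,
        OneLoop.HI.closure ⟨OneLoop.ket 0, h⟩ = 0) ∧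
    OneLoop.pointSpectrum OneLoop.HI.closure = {0} := by
  refine ⟨OneLoop.HI_domain, OneLoop.dense_finiteStates, OneLoop.HI_isFormalAdjoint,
    OneLoop.HI_isClosable, ?_, ⟨OneLoop.orthonormal_ket.ne_zero 0, ?_⟩, ?_⟩
  · exact OneLoop.unboundedSpectrum_closure OneLoop.HI_isFormalAdjoint OneLoop.HI_isClosable
      OneLoop.exists_HI_apply_ketBasis
  · rw [← OneLoop.ketBasis_apply 0]
    exact OneLoop.exists_closure_apply_basis_zero OneLoop.exists_HI_apply_ketBasis
  · exact OneLoop.pointSpectrum_closure OneLoop.HI_isFormalAdjoint OneLoop.HI_isClosable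
      OneLoop.exists_HI_apply_ketBasis
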